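/- **Theorem.** Let $d\in\{0,1\}$, and put $h_0=\cosh$, $h_1=\sinh$. Let $(\beta_N)_{N\ge1}$ and $(\gamma_N)_{N\ge1}$ be increasing sequences of positive numbers and $(\delta_N)_{N\ge1}$ a decreasing sequence of positive numbers (all in the non-strict sense) with $\beta_N\to\infty$, $\gamma_N\to\infty$, $\delta_N^{-1}\to\infty$. Let $(P_{2N+d})_{N\ge1}$ belong to the class $\mathcal P_d(\beta,\gamma,\delta)$, that is: $P_{2N+d}$ is a monic real polynomial of degree $2N+d$, even if $d=0$ and odd if $d=1$, all of whose complex zeros are real and simple, and there is a constant $c>0$ such that for all $N\ge1$ and all $z\in\mathbb C$ with $|z|\le\gamma_N$, $$\left|\frac{\beta_N^d\,P_{2N+d}(z/\beta_N)}{P_{2N+d}^{(d)}(0)}-\cos\left(z-\frac{d\pi}{2}\right)\right|\le c\,\delta_N\min(|z|^2,1)\,h_d(|z|).$$ For each $N\ge1$ let $x_1=x_{1,N},\dots,x_N=x_{N,N}$ be the (exactly $N$) positive zeros of $P_{2N+d}$, listed without repetition. Let $(u_N)_{N\ge1}$ be positive numbers with $u_N\notin\{x_{1,N},\dots,x_{N,N}\}$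 and $\beta_Nu_N\to\infty$. Put $\Omega_N=\{0,u_N^2,x_{1,N}^2,\dots,x_{N,N}^2\}$. For a set $\Omega$ of $N+2$ real numbers with $\min\Omega=0$ let $W(v)=\prod_{w\in\Omega}(v-w)$, let $$B_N(t,\Omega)=(N+1)\sum_{v\in\Omega}\frac{(v-t)_+^N}{W'(v)}\quad(t\in\mathbb R)$$ be the B-spline of degree $N$ with knots $\Omega$, and let $B_N^*(t,\Omega)=t^{-N}B_N(t,\Omega)$ be the associated B-spline, where $B_N^*(0,\Omega)=\lim_{t\to0+}t^{-N}B_N(t,\Omega)$. For $t>0$ let $$\varTheta_0(t)=1-\frac4\pi\sum_{k=0}^\infty(-1)^k\frac{\exp\left(-(\pi^2/4)(2k+1)^2t^{-1}\right)}{2k+1},\qquad \varTheta_1(t)=1+2\sum_{k=1}^\infty(-1)^k\exp\left(-(\pi k)^2t^{-1}\right).$$ Then for every $s\in\mathbb C$ with $\operatorname{Re}s>d$ the integrals below converge absolutely for every $N\ge1$, and $$\lim_{N\to\infty}\left[\frac{u_N^2\prod_{k=1}^Nx_{k,N}^2}{N}\int_0^\infty B_N^*\left(\frac{N}{\beta_N^2}t,\Omega_N\right)t^{(s-d)/2-1}\,dt\right]=\int_0^\infty\varTheta_d(t)\,t^{(s-d)/2-1}\,dt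 .$$ Moreover, for every real $r>d$, the convergence is uniform in $s$ on every compact subset of the line $\operatorname{Re}s=r$. -/

import Mathlib

open Filter Topology Polynomial

noncomputable section

namespace BSplineMellin

/-- The B-spline of degree `N` with set of knots `Ω` (of `N + 2` points),
`B_N(t, Ω) = (N + 1) ∑_{v ∈ Ω} (v - t)₊ ^ N / W'(v)`, where `W(u) = ∏_{v ∈ Ω} (u - v)`. -/
def bSpline (N : ℕ) (Ω : Finset ℝ) (t : ℝ) : ℝ :=
  ((N : ℝ) + 1) * ∑ v ∈ Ω, (max (v - t) 0) ^ N / (derivative (∏ w ∈ Ω, (X - C w))).eval v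

/-- The associated B-spline `B_N^*(t, Ω) = t^{-N} B_N(t, Ω)`, with value at `t = 0` equal to the
limit of `t^{-N} B_N(t, Ω)` as `t → 0+`. -/
def bSplineStar (N : ℕ) (Ω : Finset ℝ) (t : ℝ) : ℝ :=
  if t = 0 then limUnder (𝓝[>] (0 : ℝ)) (fun τ : ℝ => (τ ^ N)⁻¹ * bSpline N Ω τ)
  else (t ^ N)⁻¹ * bSpline N Ω t

/-- `h_0 = cosh` and `h_1 = sinh`. -/
def hyp (d : ℕ) (x : ℝ) : ℝ :=
  if d = 0 then Real.cosh x else Real.sinh x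

/-- The theta-like functions, for `t > 0`:
`Θ_0(t) = 1 - (4/π) ∑_{k ≥ 0} (-1)^k exp(-(π²/4)(2k+1)²/t) / (2k+1)`,
`Θ_1(t) = 1 + 2 ∑_{k ≥ 1} (-1)^k exp(-(πk)²/t)`; the last sum is indexed by `k + 1` with `k ≥ 0`. -/
def thetaLike (d : ℕ) (t : ℝ) : ℝ :=
  if d = 0 then
    1 - 4 / Real.pi *
      ∑' k : ℕ, (-1 : ℝ) ^ k * Real.exp (-(Real.pi ^ 2 / 4) * (2 * (k : ℝ) + 1) ^ 2 * t⁻¹) /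
        (2 * (k : ℝ) + 1)
  else
    1 + 2 * ∑' k : ℕ, (-1 : ℝ) ^ (k + 1) * Real.exp (-(Real.pi * ((k : ℝ) + 1)) ^ 2 * t⁻¹)

/-- The class `𝒫_d(β, γ, δ)`, `d ∈ {0, 1}`. The member of degree `2N + d` of the sequence is `P N`;
only the indices `N ≥ 1` matter. -/
structure PolyClass (d : ℕ) (β γ δ : ℕ → ℝ) (P : ℕ → ℝ[X]) : Prop where
  beta_pos : ∀ N, 1 ≤ N → 0 < β N
  gamma_pos : ∀ N, 1 ≤ N → 0 < γ N
  delta_pos : ∀ N, 1 ≤ N → 0 < δ N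
  beta_mono : MonotoneOn β (Set.Ici 1)
  gamma_mono : MonotoneOn γ (Set.Ici 1)
  delta_anti : AntitoneOn δ (Set.Ici 1)
  beta_lim : Tendsto β atTop atTop
  gamma_lim : Tendsto γ atTop atTop
  delta_lim : Tendsto (fun N => (δ N)⁻¹) atTop atTop
  monic : ∀ N, 1 ≤ N → (P N).Monic
  natDegree_eq : ∀ N, 1 ≤ N → (P N).natDegree = 2 * N + d
  /-- `P N` is even if `d = 0` and odd if `d = 1`. -/
  parity : ∀ N, 1 ≤ N → (P N).comp (-X) = (-1) ^ d * P N
  /-- All complex zeros of `P N` are real. -/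
  real_zeros : ∀ N, 1 ≤ N → ∀ z : ℂ, aeval z (P N) = 0 → z.im = 0
  /-- All zeros of `P N` have multiplicity one. -/
  simple_zeros : ∀ N, 1 ≤ N → ∀ x : ℝ, (P N).IsRoot x → (P N).rootMultiplicity x = 1
  /-- The asymptotic property on the disks `|z| ≤ γ_N`, with a constant independent of `N`, `z`. -/
  asymp : ∃ c : ℝ, 0 < c ∧ ∀ N, 1 ≤ N → ∀ z : ℂ, ‖z‖ ≤ γ N →
    ‖(β N : ℂ) ^ d * aeval (z / (β N : ℂ)) (P N) / (((derivative^[d] (P N)).eval 0 : ℝ) : ℂ)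
        - Complex.cos (z - d * Real.pi / 2)‖
      ≤ c * (δ N * min (‖z‖ ^ 2) 1 * hyp d ‖z‖)

/-- The set of knots `{0, u², x_1², …, x_N²}`. -/
def knots (N : ℕ) (u : ℝ) (x : ℕ → ℝ) : Finset ℝ :=
  insert 0 (insert (u ^ 2) ((Finset.Icc 1 N).image fun k => x k ^ 2))

/-- The scaled Mellin transform
`(u² ∏_{k=1}^N x_k² / N) ∫_0^∞ B_N^*((N / b²) t, {0, u², x_1², …, x_N²}) t^{w-1} dt`. -/
def scaledMellin (N : ℕ) (b u : ℝ) (x : ℕ → ℝ) (w : ℂ) : ℂ :=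
  ((u ^ 2 * (∏ k ∈ Finset.Icc 1 N, x k ^ 2) / N : ℝ) : ℂ) *
    mellin (fun t : ℝ => ((bSplineStar N (knots N u x) (N / b ^ 2 * t) : ℝ) : ℂ)) w

end BSplineMellin

end

noncomputable section

namespace BSplineMellin

open MeasureTheory Set

/-! ### Mellin transforms of multiplicative convolutions -/

/-! The scaled spline is not studied pointwise; it is identified through a multiplicative
convolution. Write `w = (s - d) / 2`, `V` for the nonzero knots and `b = β N`. Convolving the scaled
spline in `dt / t` with the kernel `q (1 + q/N)^(-N-2)` gives exactly `∏_{v ∈ V} (1 + q / (b² v))⁻¹`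
(`integral_scaled_bSplineStar_mul`): each truncated power integrates in closed form against the
kernel, and the sum over knots is a partial fraction expansion. The Mellin transform turns
convolution into a product, so the scaled transform is a quotient of two Mellin transforms.

Both have limits. On the imaginary axis, `z = i√q`, the asymptotic hypothesis makes the product over
`V` tend to `C(q)`, which is `cosh √q` or `sinh √q / √q`; the extra knot `u²` contributes a factor
tending to 1. The kernel tends to `q e^(-q)`, whose transform is `Γ(w + 1)`. Dominated convergence
needs a lower bound for the products that is uniform in `N` and has power growth of any order. It
follows from one inequality at one point, because `E(4q) / E(q)` is increasing in `q` for every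
product `E` of this form (`exists_eventually_pow_le_prod`). Convergence in weighted `L¹` is then
uniform on the whole line `Re w = σ`; compactness enters only to keep `Γ(w + 1)` away from zero.

The limit must still be recognised as the transform of the theta-like function. As a function of `τ
= 1/t`, that function is the distribution function of an infinite sum of independent exponential
variables whose rates are the squared zeros of `cos z` or `sin z / z`. Its convolution with `q
e^(-q)` is the Laplace transform of that sum, namely `1 / C(q)` by Euler's product. Finite sums are
treated by explicit coefficients and a passage to the limit, which gives `hasMellin_thetaLike`. -/

lemma integral_rpow_mul_comp_inv_mul (g : ℝ → ℝ) (σ : ℝ) {t : ℝ} (ht : 0 < t) :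
    ∫ p in Ioi 0, p ^ (σ - 1) * g (p / t) = t ^ σ * ∫ p in Ioi 0, p ^ (σ - 1) * g p := by
  have h1 := integral_comp_mul_left_Ioi (fun p : ℝ => p ^ (σ - 1) * g p) 0 (inv_pos.2 ht)
  rw [inv_inv, mul_zero, smul_eq_mul] at h1
  have h2 : ∫ p in Ioi 0, p ^ (σ - 1) * g (p / t) =
      ∫ p in Ioi 0, t ^ (σ - 1) * ((t⁻¹ * p) ^ (σ - 1) * g (t⁻¹ * p)) := by
    refine setIntegral_congr_fun measurableSet_Ioi fun p hp => ?_
    have hp' : (0 : ℝ) < p := hp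
    rw [← mul_assoc, ← Real.mul_rpow ht.le (by positivity), mul_inv_cancel_left₀ ht.ne',
      div_eq_inv_mul]
  rw [h2, integral_const_mul, h1, ← mul_assoc, ← Real.rpow_add_one ht.ne', sub_add_cancel]

lemma integrableOn_rpow_mul_comp_div {g : ℝ → ℝ} {σ : ℝ}
    (hg : IntegrableOn (fun p => p ^ (σ - 1) * g p) (Ioi 0)) {t : ℝ} (ht : 0 < t) :
    IntegrableOn (fun p => p ^ (σ - 1) * g (p / t)) (Ioi 0) := by
  have h1 := (integrableOn_Ioi_comp_mul_left_iff (fun p : ℝ => p ^ (σ - 1) * g p) 0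
    (inv_pos.2 ht)).2 (by simpa using hg)
  refine IntegrableOn.congr_fun (h1.const_mul (t ^ (σ - 1))) (fun p hp => ?_) measurableSet_Ioi
  have hp' : (0 : ℝ) < p := hp
  rw [← mul_assoc, ← Real.mul_rpow ht.le (by positivity), mul_inv_cancel_left₀ ht.ne',
    div_eq_inv_mul]

lemma mellinConvergent_ofReal_iff {f : ℝ → ℝ} (hf : Measurable f) (w : ℂ) :
    MellinConvergent (fun t => (f t : ℂ)) w ↔
      IntegrableOn (fun t => t ^ (w.re - 1) * |f t|) (Ioi 0) := by
  have := mellin_convergent_iff_norm (f := fun t => (f t : ℂ)) (s := w) Subset.rfl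
    measurableSet_Ioi (Complex.measurable_ofReal.comp hf).aestronglyMeasurable
  simpa [MellinConvergent] using this

/-- The Mellin transform of a multiplicative convolution is the product of the Mellin
transforms. -/
theorem mellin_eq_mul_of_conv {f k H : ℝ → ℝ} (hf : Measurable f) (hk : Measurable k) {w : ℂ}
    (hfw : MellinConvergent (fun t => (f t : ℂ)) w)
    (hkw : MellinConvergent (fun t => (k t : ℂ)) w)
    (hH : ∀ p, 0 < p → ∫ t in Ioi 0, f t * k (p / t) / t = H p) :
    mellin (fun t => (H t : ℂ)) w =
      mellin (fun t => (f t : ℂ)) w * mellin (fun t => (k t : ℂ)) w := by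
  set μ : Measure ℝ := volume.restrict (Ioi 0) with hμ
  let Φ : ℝ → ℝ → ℂ := fun t p => (p : ℂ) ^ (w - 1) * ((f t * k (p / t) / t : ℝ) : ℂ)
  have hΦm : Measurable (Function.uncurry Φ) := by
    unfold Φ Function.uncurry
    fun_prop
  have hnorm : ∀ t, 0 < t → ∀ p, 0 < p →
      ‖Φ t p‖ = |f t| / t * (p ^ (w.re - 1) * |k (p / t)|) := by
    intro t ht p hp
    simp only [Φ, norm_mul, Complex.norm_cpow_eq_rpow_re_of_pos hp, Complex.norm_real,
      Complex.sub_re, Complex.one_re, Real.norm_eq_abs, abs_div, abs_mul, abs_of_pos ht]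
    ring
  have hkR := (mellinConvergent_ofReal_iff hk w).1 hkw
  have hfR := (mellinConvergent_ofReal_iff hf w).1 hfw
  have hint : Integrable (Function.uncurry Φ) (μ.prod μ) := by
    rw [integrable_prod_iff hΦm.aestronglyMeasurable]
    constructor
    · filter_upwards [ae_restrict_mem measurableSet_Ioi] with t ht
      have h1 : Integrable (fun p => |f t| / t * (p ^ (w.re - 1) * |k (p / t)|)) μ :=
        (integrableOn_rpow_mul_comp_div hkR ht).const_mul _
      refine h1.mono' (hΦm.comp measurable_prodMk_left).aestronglyMeasurable ?_
      filter_upwards [ae_restrict_mem measurableSet_Ioi] with p hp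
      exact (hnorm t ht p hp).le
    · have h1 := hfR.mul_const (∫ p in Ioi 0, p ^ (w.re - 1) * |k p|)
      refine IntegrableOn.congr_fun h1 (fun t ht => ?_) measurableSet_Ioi
      have ht' : (0 : ℝ) < t := ht
      have h2 : ∫ p, ‖Φ t p‖ ∂μ = ∫ p in Ioi 0, |f t| / t * (p ^ (w.re - 1) * |k (p / t)|) :=
        setIntegral_congr_fun measurableSet_Ioi fun p hp => hnorm t ht p hp
      simp only [Function.uncurry]
      rw [h2, integral_const_mul, integral_rpow_mul_comp_inv_mul (fun x => |k x|) _ ht',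
        Real.rpow_sub_one ht'.ne']
      ring
  have hswap := integral_integral_swap hint
  have hR : ∫ p, ∫ t, Φ t p ∂μ ∂μ = mellin (fun t => (H t : ℂ)) w := by
    refine setIntegral_congr_fun measurableSet_Ioi fun p hp => ?_
    simp only [Φ, smul_eq_mul]
    rw [integral_const_mul, integral_complex_ofReal, ← hH p hp]
  have hL : ∫ t, ∫ p, Φ t p ∂μ ∂μ =
      mellin (fun t => (f t : ℂ)) w * mellin (fun t => (k t : ℂ)) w := by
    have : ∫ t, ∫ p, Φ t p ∂μ ∂μ =
        ∫ t in Ioi (0 : ℝ), ((t : ℂ) ^ (w - 1) • (f t : ℂ)) * mellin (fun t => (k t : ℂ)) w := by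
      refine setIntegral_congr_fun measurableSet_Ioi fun t ht => ?_
      have ht' : (0 : ℝ) < t := ht
      have h3 := mellin_comp_mul_left (fun t => (k t : ℂ)) w (inv_pos.2 ht')
      have h4 : ((t⁻¹ : ℝ) : ℂ) ^ (-w) = (t : ℂ) ^ w := by
        rw [Complex.ofReal_inv, Complex.inv_cpow_eq_ite,
          if_neg (by rw [Complex.arg_ofReal_of_nonneg ht'.le]; exact Real.pi_pos.ne),
          Complex.cpow_neg, inv_inv]
      rw [h4, mellin] at h3
      have h5 : ∫ p, Φ t p ∂μ = ∫ p in Ioi (0 : ℝ), ((f t : ℂ) / t) *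
          ((p : ℂ) ^ (w - 1) • ((k (t⁻¹ * p) : ℝ) : ℂ)) := by
        refine setIntegral_congr_fun measurableSet_Ioi fun p hp => ?_
        simp only [Φ, smul_eq_mul, div_eq_inv_mul]
        push_cast
        ring
      have ht0 : (t : ℂ) ≠ 0 := by exact_mod_cast ht'.ne'
      rw [h5, integral_const_mul, h3, Complex.cpow_sub _ _ ht0, Complex.cpow_one]
      simp only [smul_eq_mul]
      ring
    rw [this, integral_mul_const]
    rfl
  rw [← hR, ← hswap, hL]

/-- If a multiplicative convolution of nonnegative functions has a convergent Mellin transform,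
then so does the first factor. -/
theorem mellinConvergent_of_conv {f k H : ℝ → ℝ} (hf : Measurable f) (hk : Measurable k)
    (hf0 : ∀ t, 0 < t → 0 ≤ f t) (hk0 : ∀ t, 0 < t → 0 ≤ k t) {w : ℂ}
    (hkpos : 0 < ∫ p in Ioi 0, p ^ (w.re - 1) * k p)
    (hsec : ∀ p, 0 < p → IntegrableOn (fun t => f t * k (p / t) / t) (Ioi 0))
    (hH : ∀ p, 0 < p → ∫ t in Ioi 0, f t * k (p / t) / t = H p)
    (hHw : IntegrableOn (fun p => p ^ (w.re - 1) * H p) (Ioi 0)) :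
    MellinConvergent (fun t => (f t : ℂ)) w := by
  set μ : Measure ℝ := volume.restrict (Ioi 0) with hμ
  let Φ : ℝ → ℝ → ℝ := fun t p => p ^ (w.re - 1) * (f t * k (p / t) / t)
  have hΦm : Measurable (Function.uncurry Φ) := by
    unfold Φ Function.uncurry
    fun_prop
  have hint : Integrable (Function.uncurry Φ) (μ.prod μ) := by
    -- The order of integration is chosen so that the inner integral over `t` is the known function
    -- `H`. Integrating in the other order afterwards leaves the transform of `f` times a positive
    -- constant, which is divided out.
    rw [integrable_prod_iff' hΦm.aestronglyMeasurable]
    constructor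
    · filter_upwards [ae_restrict_mem measurableSet_Ioi] with p hp
      exact (hsec p hp).integrable.const_mul (p ^ (w.re - 1))
    · refine IntegrableOn.congr_fun hHw (fun p hp => ?_) measurableSet_Ioi
      have hp' : (0 : ℝ) < p := hp
      have h2 : ∫ t, ‖Φ t p‖ ∂μ = ∫ t in Ioi 0, p ^ (w.re - 1) * (f t * k (p / t) / t) := by
        refine setIntegral_congr_fun measurableSet_Ioi fun t ht => ?_
        have ht' : (0 : ℝ) < t := ht
        refine Real.norm_of_nonneg ?_
        have := hf0 t ht
        have := hk0 (p / t) (by positivity)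
        positivity
      simp only [Function.uncurry]
      rw [h2, integral_const_mul, hH p hp']
  have h := hint.integral_prod_left
  have hres : IntegrableOn (fun t => (t ^ (w.re - 1) * |f t|) *
      ∫ p in Ioi 0, p ^ (w.re - 1) * k p) (Ioi 0) := by
    refine IntegrableOn.congr_fun h (fun t ht => ?_) measurableSet_Ioi
    have ht' : (0 : ℝ) < t := ht
    have h2 : ∫ p, Φ t p ∂μ = ∫ p in Ioi 0, f t / t * (p ^ (w.re - 1) * k (p / t)) :=
      setIntegral_congr_fun measurableSet_Ioi fun p hp => by simp only [Φ]; ring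
    simp only [Function.uncurry]
    rw [h2, integral_const_mul, integral_rpow_mul_comp_inv_mul k _ ht', abs_of_nonneg (hf0 t ht),
      Real.rpow_sub_one ht'.ne']
    ring
  rw [mellinConvergent_ofReal_iff hf]
  refine IntegrableOn.congr_fun (hres.mul_const (∫ p in Ioi 0, p ^ (w.re - 1) * k p)⁻¹)
    (fun t _ => ?_) measurableSet_Ioi
  exact mul_inv_cancel_right₀ hkpos.ne' _

/-! ### Reciprocals of convergent products -/

/-- Choose `n` with `4^n ≤ q/q₀ < 4^(n+1)`: iterating the growth step `n` times from `q₀` loses at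
most one factor 4, whence `4 * q₀` in the bound. -/
lemma div_pow_le_of_forall_mul_le {E : ℝ → ℝ} {q₀ : ℝ} (hq₀ : 0 < q₀) {k : ℕ}
    (hE1 : ∀ q, 0 < q → 1 ≤ E q) (hmono : ∀ p q, 0 < p → p ≤ q → E p ≤ E q)
    (hstep : ∀ q, q₀ ≤ q → 4 ^ k * E q ≤ E (4 * q)) {q : ℝ} (hq : 0 < q) :
    (q / (4 * q₀)) ^ k ≤ E q := by
  rcases le_or_gt q q₀ with h | h
  · refine le_trans (pow_le_one₀ (by positivity) ?_) (hE1 q hq)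
    rw [div_le_one (by positivity)]
    linarith
  · obtain ⟨n, hn1, hn2⟩ := exists_nat_pow_near (x := q / q₀) (y := (4 : ℝ))
      ((one_le_div hq₀).2 h.le) (by norm_num)
    have hind : ∀ n : ℕ, ((4 : ℝ) ^ n) ^ k ≤ E (4 ^ n * q₀) := by
      intro n
      induction n with
      | zero => simpa using hE1 q₀ hq₀
      | succ m ih =>
        have h1 : q₀ ≤ 4 ^ m * q₀ := le_mul_of_one_le_left hq₀.le (one_le_pow₀ (by norm_num))
        have h2 := hstep _ h1
        rw [pow_succ' (4 : ℝ) m, mul_assoc, mul_pow]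
        exact (mul_le_mul_of_nonneg_left ih (by positivity)).trans h2
    refine le_trans ?_ ((hind n).trans (hmono _ _ (by positivity) ((le_div_iff₀ hq₀).1 hn1)))
    gcongr
    rw [div_le_iff₀ (by positivity)]
    rw [div_lt_iff₀ hq₀, pow_succ] at hn2
    nlinarith

section Products

variable {ι : Type*}

/-- Each quotient `(1 + 4qy) / (1 + qy)` increases with `q`; cross-multiplied, the difference is
`3(q - p)y`. A growth factor attained at one point therefore persists at all larger points. -/
lemma prod_mul_le_prod_mul (s : Finset ι) {y : ι → ℝ} (hy : ∀ j ∈ s, 0 ≤ y j) {p q : ℝ}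
    (hp : 0 < p) (hpq : p ≤ q) :
    (∏ j ∈ s, (1 + 4 * p * y j)) * ∏ j ∈ s, (1 + q * y j) ≤
      (∏ j ∈ s, (1 + 4 * q * y j)) * ∏ j ∈ s, (1 + p * y j) := by
  rw [← Finset.prod_mul_distrib, ← Finset.prod_mul_distrib]
  refine Finset.prod_le_prod (fun j hj => ?_) fun j hj => ?_
  · have := hy j hj
    have : 0 < q := hp.trans_le hpq
    positivity
  · nlinarith [mul_nonneg (sub_nonneg.2 hpq) (hy j hj)]

lemma one_le_prod_one_add (s : Finset ι) {y : ι → ℝ} (hy : ∀ j ∈ s, 0 ≤ y j) {q : ℝ}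
    (hq : 0 < q) : 1 ≤ ∏ j ∈ s, (1 + q * y j) :=
  Finset.prod_const_one.symm.trans_le <| Finset.prod_le_prod (fun _ _ => zero_le_one) fun j hj =>
    le_add_of_nonneg_right (mul_nonneg hq.le (hy j hj))

/-- Products `∏ (1 + q y_j)` converging to a function of superpolynomial growth are eventually
bounded below by any power of `q`, uniformly in `q`. -/
lemma exists_eventually_pow_le_prod {s : ℕ → Finset ι} {y : ℕ → ι → ℝ} {C : ℝ → ℝ}
    (hy : ∀ᶠ N in atTop, ∀ j ∈ s N, 0 ≤ y N j)
    (hlim : ∀ q, 0 < q → Tendsto (fun N => ∏ j ∈ s N, (1 + q * y N j)) atTop (𝓝 (C q)))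
    (hC : ∀ M : ℝ, ∃ q, 0 < q ∧ M * C q < C (4 * q)) (k : ℕ) :
    ∃ Q, 0 < Q ∧ ∀ᶠ N in atTop, ∀ q, 0 < q →
      (1 + (q / Q) ^ k) / 2 ≤ ∏ j ∈ s N, (1 + q * y N j) := by
  obtain ⟨q₀, hq₀, hlt⟩ := hC (4 ^ k)
  refine ⟨4 * q₀, by positivity, ?_⟩
  have h1 := ((hlim q₀ hq₀).const_mul (4 ^ k)).eventually_lt (hlim (4 * q₀) (by positivity)) hlt
  filter_upwards [hy, h1] with N hyN hN q hq
  set E : ℝ → ℝ := fun q => ∏ j ∈ s N, (1 + q * y N j) with hEdef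
  have hE1 : ∀ q, 0 < q → 1 ≤ E q := fun q hq => one_le_prod_one_add _ hyN hq
  have hmono : ∀ p q, 0 < p → p ≤ q → E p ≤ E q := fun p q hp hpq =>
    Finset.prod_le_prod (fun j hj => by have := hyN j hj; positivity) fun j hj => by
      have := hyN j hj
      gcongr
  have hstep : ∀ q, q₀ ≤ q → 4 ^ k * E q ≤ E (4 * q) := by
    intro q hq
    have h2 : E (4 * q₀) * E q ≤ E (4 * q) * E q₀ := prod_mul_le_prod_mul _ hyN hq₀ hq
    have hEq0 : 0 < E q₀ := zero_lt_one.trans_le (hE1 q₀ hq₀)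
    have hEq : 0 < E q := zero_lt_one.trans_le (hE1 q (hq₀.trans_le hq))
    have h3 : 4 ^ k * E q₀ ≤ E (4 * q₀) := le_of_lt hN
    have h4 : (4 ^ k * E q) * E q₀ ≤ E (4 * q) * E q₀ := by nlinarith
    exact le_of_mul_le_mul_right h4 hEq0
  have := div_pow_le_of_forall_mul_le hq₀ hE1 hmono hstep hq
  have := hE1 q hq
  change _ ≤ E q
  linarith

lemma integrableOn_rpow_mul_inv_one_add_pow {Q σ : ℝ} (hQ : 0 < Q) (hσ : 0 < σ) {k : ℕ}
    (hk : σ < k) :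
    IntegrableOn (fun q : ℝ => q ^ (σ - 1) * (2 / (1 + (q / Q) ^ k))) (Ioi 0) := by
  refine mellin_convergent_of_isBigO_scalar (a := k) (b := 0) ?_ ?_ hk ?_ hσ
  · refine ContinuousOn.locallyIntegrableOn ?_ measurableSet_Ioi
    refine ContinuousOn.div (by fun_prop) (by fun_prop) fun q hq => ?_
    have : (0 : ℝ) < q := hq
    positivity
  · refine Asymptotics.IsBigO.of_bound (2 * Q ^ k) ?_
    filter_upwards [eventually_gt_atTop 0] with q hq
    rw [Real.norm_of_nonneg (by positivity), Real.norm_of_nonneg (by positivity),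
      Real.rpow_neg hq.le, Real.rpow_natCast, ← div_eq_mul_inv, div_le_div_iff₀ (by positivity)
      (by positivity), div_pow]
    have : Q ^ k * (1 + q ^ k / Q ^ k) = Q ^ k + q ^ k := by field_simp
    nlinarith [pow_pos hQ k]
  · refine Asymptotics.IsBigO.of_bound 2 ?_
    filter_upwards [self_mem_nhdsWithin] with q hq
    have hq : (0 : ℝ) < q := hq
    rw [Real.norm_of_nonneg (by positivity), neg_zero, Real.rpow_zero, norm_one, mul_one]
    exact div_le_self (by norm_num) (le_add_of_nonneg_right (by positivity))

/-- Dominated convergence for reciprocals of products `∏ (1 + q y_j)`. -/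
theorem tendsto_integral_abs_inv_prod_sub {s : ℕ → Finset ι} {y : ℕ → ι → ℝ} {C : ℝ → ℝ}
    (hy : ∀ᶠ N in atTop, ∀ j ∈ s N, 0 ≤ y N j)
    (hlim : ∀ q, 0 < q → Tendsto (fun N => ∏ j ∈ s N, (1 + q * y N j)) atTop (𝓝 (C q)))
    (hC : ∀ M : ℝ, ∃ q, 0 < q ∧ M * C q < C (4 * q)) {σ : ℝ} (hσ : 0 < σ) :
    (∀ᶠ N in atTop,
      IntegrableOn (fun q => q ^ (σ - 1) * (∏ j ∈ s N, (1 + q * y N j))⁻¹) (Ioi 0)) ∧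
    IntegrableOn (fun q => q ^ (σ - 1) * (C q)⁻¹) (Ioi 0) ∧
    Tendsto (fun N => ∫ q in Ioi 0,
      |q ^ (σ - 1) * (∏ j ∈ s N, (1 + q * y N j))⁻¹ - q ^ (σ - 1) * (C q)⁻¹|) atTop (𝓝 0) := by
  obtain ⟨k, hk⟩ := exists_nat_gt σ
  obtain ⟨Q, hQ, hbd⟩ := exists_eventually_pow_le_prod hy hlim hC k
  have hdom := integrableOn_rpow_mul_inv_one_add_pow hQ hσ hk
  have hEm : ∀ N, Measurable fun q : ℝ => q ^ (σ - 1) * (∏ j ∈ s N, (1 + q * y N j))⁻¹ := by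
    intro N
    have h1 : Measurable fun q : ℝ => ∏ j ∈ s N, (1 + q * y N j) :=
      (continuous_finsetProd _ fun j _ => by fun_prop).measurable
    have h2 : Measurable fun q : ℝ => q ^ (σ - 1) := by fun_prop
    exact h2.mul h1.inv
  have hCbd : ∀ q, 0 < q → (1 + (q / Q) ^ k) / 2 ≤ C q := fun q hq =>
    ge_of_tendsto (hlim q hq) (hbd.mono fun N hN => hN q hq)
  have hinv : ∀ q x : ℝ, 0 < q → (1 + (q / Q) ^ k) / 2 ≤ x →
      ‖q ^ (σ - 1) * x⁻¹‖ ≤ q ^ (σ - 1) * (2 / (1 + (q / Q) ^ k)) := by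
    intro q x hq hx
    have h0 : 0 < (1 + (q / Q) ^ k) / 2 := by positivity
    have hx0 : 0 < x := h0.trans_le hx
    rw [Real.norm_of_nonneg (by positivity)]
    have := inv_anti₀ h0 hx
    rw [inv_div] at this
    gcongr
  have hptw : ∀ᵐ q ∂(volume.restrict (Ioi (0 : ℝ))),
      Tendsto (fun N => q ^ (σ - 1) * (∏ j ∈ s N, (1 + q * y N j))⁻¹) atTop
        (𝓝 (q ^ (σ - 1) * (C q)⁻¹)) := by
    filter_upwards [ae_restrict_mem measurableSet_Ioi] with q hq
    have hq : (0 : ℝ) < q := hq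
    have h0 : 0 < (1 + (q / Q) ^ k) / 2 := by positivity
    exact ((hlim q hq).inv₀ (h0.trans_le (hCbd q hq)).ne').const_mul _
  have hCm : AEStronglyMeasurable (fun q => q ^ (σ - 1) * (C q)⁻¹) (volume.restrict (Ioi 0)) :=
    aestronglyMeasurable_of_tendsto_ae atTop (fun N => (hEm N).aestronglyMeasurable) hptw
  have hCint : IntegrableOn (fun q => q ^ (σ - 1) * (C q)⁻¹) (Ioi 0) := by
    refine Integrable.mono' hdom hCm ?_
    filter_upwards [ae_restrict_mem measurableSet_Ioi] with q hq
    exact hinv q _ hq (hCbd q hq)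
  refine ⟨?_, hCint, ?_⟩
  · filter_upwards [hbd] with N hN
    refine Integrable.mono' hdom (hEm N).aestronglyMeasurable ?_
    filter_upwards [ae_restrict_mem measurableSet_Ioi] with q hq
    exact hinv q _ hq (hN q hq)
  · suffices Tendsto (fun N => ∫ q in Ioi 0,
        |q ^ (σ - 1) * (∏ j ∈ s N, (1 + q * y N j))⁻¹ - q ^ (σ - 1) * (C q)⁻¹|) atTop
        (𝓝 (∫ _ in Ioi (0 : ℝ), (0 : ℝ))) by simpa using this
    refine tendsto_integral_filter_of_dominated_convergence
      (fun q => 2 * (q ^ (σ - 1) * (2 / (1 + (q / Q) ^ k)))) ?_ ?_ (hdom.const_mul 2) ?_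
    · exact Eventually.of_forall fun N => ((hEm N).aestronglyMeasurable.sub hCm).norm
    · filter_upwards [hbd] with N hN
      filter_upwards [ae_restrict_mem measurableSet_Ioi] with q hq
      have h1 := hinv q _ hq (hCbd q hq)
      have h2 := hinv q _ hq (hN q hq)
      rw [Real.norm_eq_abs, abs_abs, ← Real.norm_eq_abs]
      exact (norm_sub_le _ _).trans (by linarith)
    · filter_upwards [hptw] with q hq
      simpa using (hq.sub_const (q ^ (σ - 1) * (C q)⁻¹)).abs

end Products

/-! ### Uniform convergence of Mellin transforms and of quotients -/

/-- Convergence in `L¹` with weight `q ^ (σ - 1)` gives convergence of Mellin transforms, uniformly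
on the line `Re w = σ`. -/
theorem tendstoUniformlyOn_mellin_of_tendsto {F : ℕ → ℝ → ℝ} {G : ℝ → ℝ} {σ : ℝ}
    (hF : ∀ᶠ N in atTop, IntegrableOn (fun q => q ^ (σ - 1) * F N q) (Ioi 0))
    (hG : IntegrableOn (fun q => q ^ (σ - 1) * G q) (Ioi 0))
    (hlim : Tendsto (fun N => ∫ q in Ioi 0, |q ^ (σ - 1) * F N q - q ^ (σ - 1) * G q|)
      atTop (𝓝 0)) :
    TendstoUniformlyOn (fun N w => mellin (fun q => (F N q : ℂ)) w)
      (fun w => mellin (fun q => (G q : ℂ)) w) atTop {w : ℂ | w.re = σ} := by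
  have hconv : ∀ H : ℝ → ℝ, IntegrableOn (fun q => q ^ (σ - 1) * H q) (Ioi 0) →
      ∀ w : ℂ, w.re = σ → MellinConvergent (fun q => (H q : ℂ)) w := by
    rintro H hH w rfl
    have hm : AEStronglyMeasurable (fun q => (H q : ℂ)) (volume.restrict (Ioi 0)) := by
      have h1 : AEStronglyMeasurable (fun q : ℝ => (q ^ (w.re - 1))⁻¹ * (q ^ (w.re - 1) * H q))
          (volume.restrict (Ioi 0)) := by
        refine AEStronglyMeasurable.mul ?_ hH.aestronglyMeasurable
        exact Measurable.aestronglyMeasurable (by fun_prop)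
      refine Complex.continuous_ofReal.comp_aestronglyMeasurable (h1.congr ?_)
      filter_upwards [ae_restrict_mem measurableSet_Ioi] with q hq
      rw [inv_mul_cancel_left₀ (Real.rpow_pos_of_pos hq _).ne']
    rw [MellinConvergent, mellin_convergent_iff_norm Subset.rfl measurableSet_Ioi hm]
    refine IntegrableOn.congr_fun hH.norm (fun q hq => ?_) measurableSet_Ioi
    simp [abs_of_pos (Real.rpow_pos_of_pos (show (0 : ℝ) < q from hq) _)]
  rw [Metric.tendstoUniformlyOn_iff]
  intro ε hε
  filter_upwards [hF, hlim.eventually_lt_const hε] with N hN hlt w hw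
  have hw : w.re = σ := hw
  rw [dist_comm, dist_eq_norm, mellin, mellin,
    ← integral_sub (hconv _ hN w hw) (hconv _ hG w hw)]
  refine (norm_integral_le_integral_norm _).trans_lt (lt_of_eq_of_lt ?_ hlt)
  refine setIntegral_congr_fun measurableSet_Ioi fun q hq => ?_
  have hq : (0 : ℝ) < q := hq
  simp only
  rw [← smul_sub, norm_smul, Complex.norm_cpow_eq_rpow_re_of_pos hq, ← Complex.ofReal_sub,
    Complex.norm_real, ← mul_sub, abs_mul, abs_of_pos (Real.rpow_pos_of_pos hq _),
    Real.norm_eq_abs, Complex.sub_re, Complex.one_re, hw]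

/-- Uniform convergence of quotients on a set where the limit of the denominators is bounded away
from zero and the limit of the numerators is bounded. -/
theorem tendstoUniformlyOn_div_of_bounds {A B : ℕ → ℂ → ℂ} {a b : ℂ → ℂ} {K : Set ℂ}
    (hA : TendstoUniformlyOn A a atTop K) (hB : TendstoUniformlyOn B b atTop K) {M m : ℝ}
    (hm : 0 < m) (ha : ∀ w ∈ K, ‖a w‖ ≤ M) (hb : ∀ w ∈ K, m ≤ ‖b w‖) :
    TendstoUniformlyOn (fun N w => A N w / B N w) (fun w => a w / b w) atTop K := by
  rw [Metric.tendstoUniformlyOn_iff] at *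
  intro ε hε
  have hM : 0 < |M| + 1 := by positivity
  -- The first entry keeps the denominators above `m / 2`; the other two make each of the two error
  -- terms at most `ε / 4` after division.
  set η : ℝ := min (m / 2) (min (ε * m / 8) (ε * m ^ 2 / (8 * (|M| + 1)))) with hη
  have hη0 : 0 < η := by positivity
  have hη1 : η ≤ m / 2 := min_le_left _ _
  have hη2 : η ≤ ε * m / 8 := (min_le_right _ _).trans (min_le_left _ _)
  have hη3 : η * (8 * (|M| + 1)) ≤ ε * m ^ 2 := by
    rw [← le_div_iff₀ (by positivity)]
    exact (min_le_right _ _).trans (min_le_right _ _)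
  filter_upwards [hA η hη0, hB η hη0] with N hAN hBN w hw
  have h1 := hAN w hw
  have h2 := hBN w hw
  have h3 := hb w hw
  have h4 : ‖a w‖ ≤ |M| + 1 := (ha w hw).trans ((le_abs_self M).trans (by linarith))
  rw [dist_eq_norm] at h1 h2 ⊢
  have h5 : m / 2 ≤ ‖B N w‖ := by
    have := norm_sub_norm_le (b w) (B N w)
    linarith
  have hb0 : b w ≠ 0 := norm_pos_iff.1 (hm.trans_le h3)
  have hB0 : B N w ≠ 0 := norm_pos_iff.1 ((half_pos hm).trans_le h5)
  have key : a w / b w - A N w / B N w =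
      ((a w - A N w) * b w - a w * (b w - B N w)) / (b w * B N w) := by
    field_simp
    ring
  have hbp : 0 < ‖b w‖ := hm.trans_le h3
  have hBp : 0 < ‖B N w‖ := (half_pos hm).trans_le h5
  rw [key, norm_div, norm_mul, div_lt_iff₀ (by positivity)]
  refine (norm_sub_le _ _).trans_lt ?_
  rw [norm_mul, norm_mul]
  have e1 : ‖a w - A N w‖ * ‖b w‖ ≤ (ε / 4) * (‖b w‖ * ‖B N w‖) := by
    have : ‖a w - A N w‖ ≤ (ε / 4) * ‖B N w‖ := by nlinarith
    nlinarith
  have e2 : ‖a w‖ * ‖b w - B N w‖ ≤ (ε / 4) * (‖b w‖ * ‖B N w‖) := by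
    have i1 : ‖a w‖ * ‖b w - B N w‖ ≤ (|M| + 1) * η := by gcongr
    have i2 : m * (m / 2) ≤ ‖b w‖ * ‖B N w‖ := by gcongr
    nlinarith
  have : 0 < ε * (‖b w‖ * ‖B N w‖) := by positivity
  linarith

/-! ### The B-spline with knots `{0} ∪ V` -/

/-- Partial fraction decomposition of `f / ∏ (X - v)`. -/
lemma sum_eval_div_prod_sub {V : Finset ℝ} {f : ℝ[X]} (hf : f.degree < V.card) {z : ℝ}
    (hz : z ∉ V) :
    ∑ v ∈ V, f.eval v / ((∏ w ∈ V.erase v, (v - w)) * (z - v)) =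
      f.eval z / ∏ v ∈ V, (z - v) := by
  have hinj : Set.InjOn (id : ℝ → ℝ) V := Function.injective_id.injOn
  have hne : ∀ v ∈ V, z - v ≠ 0 := fun v hv h => hz (by rwa [sub_eq_zero.1 h])
  have h1 := Lagrange.eq_interpolate hinj hf
  have h2 := Lagrange.eval_interpolate_not_at_node (s := V) (v := id) (fun i => f.eval (id i))
    (x := z) fun v hv h => hz (by rw [h]; exact hv)
  rw [← h1, Lagrange.eval_nodal] at h2
  simp only [id] at h2
  rw [h2, mul_div_cancel_left₀ _ (Finset.prod_ne_zero_iff.2 hne)]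
  refine Finset.sum_congr rfl fun v _ => ?_
  simp only [Lagrange.nodalWeight, id, Finset.prod_inv_distrib]
  rw [div_eq_mul_inv, mul_inv]
  ring

lemma eval_derivative_prod_insert_zero {V : Finset ℝ} (h0 : (0 : ℝ) ∉ V) {v : ℝ} (hv : v ∈ V) :
    (derivative (∏ w ∈ insert 0 V, (X - C w))).eval v = v * ∏ w ∈ V.erase v, (v - w) := by
  have h1 := Lagrange.eval_nodal_derivative_eval_node_eq (s := insert 0 V) (v := (id : ℝ → ℝ))
    (Finset.mem_insert_of_mem hv)
  rw [Lagrange.nodal_eq, Lagrange.eval_nodal] at h1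
  have hv0 : v ≠ 0 := fun h => h0 (h ▸ hv)
  rw [Finset.erase_insert_of_ne hv0.symm,
    Finset.prod_insert (fun h => h0 (Finset.mem_of_mem_erase h))] at h1
  simpa using h1

variable {N : ℕ} {V : Finset ℝ}

lemma bSplineStar_insert_zero (hN : 1 ≤ N) (hV : ∀ v ∈ V, 0 < v) {t : ℝ} (ht : 0 < t) :
    bSplineStar N (insert 0 V) t = (t ^ N)⁻¹ * (((N : ℝ) + 1) *
      ∑ v ∈ V, (max (v - t) 0) ^ N / (v * ∏ w ∈ V.erase v, (v - w))) := by
  have h0 : (0 : ℝ) ∉ V := fun h => (hV 0 h).false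
  rw [bSplineStar, if_neg ht.ne', bSpline, Finset.sum_insert h0, zero_sub,
    max_eq_right (neg_nonpos.2 ht.le), zero_pow (by omega), zero_div, zero_add]
  congr 2
  exact Finset.sum_congr rfl fun v hv => by rw [eval_derivative_prod_insert_zero h0 hv]

lemma measurable_bSplineStar (N : ℕ) (Ω : Finset ℝ) : Measurable (bSplineStar N Ω) := by
  unfold bSplineStar
  refine Measurable.ite (measurableSet_singleton 0) measurable_const ?_
  unfold bSpline
  fun_prop

/-- To the left of all positive knots no power is truncated, so the sum is the partial fraction
expansion of `(z - t)^N / ∏ (z - v)` at `z = 0`; its factor `t^N` cancels the normalisation. -/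
lemma bSplineStar_eq_of_lt (hN : 1 ≤ N) (hV : ∀ v ∈ V, 0 < v) (hcard : V.card = N + 1) {t : ℝ}
    (ht : 0 < t) (hlt : ∀ v ∈ V, t < v) :
    bSplineStar N (insert 0 V) t = ((N : ℝ) + 1) / ∏ v ∈ V, v := by
  have h0 : (0 : ℝ) ∉ V := fun h => (hV 0 h).false
  have hdeg : ((X - C t : ℝ[X]) ^ N).degree < V.card := by
    rw [degree_pow, degree_X_sub_C, hcard]
    simp only [nsmul_eq_mul, mul_one]
    exact_mod_cast N.lt_succ_self
  have h1 := sum_eval_div_prod_sub hdeg h0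
  have h2 : ∑ v ∈ V, (max (v - t) 0) ^ N / (v * ∏ w ∈ V.erase v, (v - w)) =
      -∑ v ∈ V, ((X - C t : ℝ[X]) ^ N).eval v / ((∏ w ∈ V.erase v, (v - w)) * (0 - v)) := by
    rw [← Finset.sum_neg_distrib]
    refine Finset.sum_congr rfl fun v hv => ?_
    rw [max_eq_left (sub_nonneg.2 (hlt v hv).le)]
    simp only [eval_pow, eval_sub, eval_X, eval_C, zero_sub, mul_neg, div_neg, neg_neg]
    rw [mul_comm v]
  rw [bSplineStar_insert_zero hN hV ht, h2, h1]
  have h3 : ∏ v ∈ V, ((0 : ℝ) - v) = (-1) ^ (N + 1) * ∏ v ∈ V, v := by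
    rw [← hcard, ← Finset.prod_const, ← Finset.prod_mul_distrib]
    exact Finset.prod_congr rfl fun v _ => by ring
  have h4 : (-t) ^ N = (-1) ^ N * t ^ N := by rw [← mul_pow, neg_one_mul]
  have hp : (∏ v ∈ V, v) ≠ 0 := Finset.prod_ne_zero_iff.2 fun v hv => (hV v hv).ne'
  simp only [eval_pow, eval_sub, eval_X, eval_C, zero_sub]
  rw [h4, ← Finset.prod_congr rfl fun v _ => zero_sub v, h3, pow_succ]
  have h5 : ((-1 : ℝ)) ^ N ≠ 0 := by simp
  field_simp

lemma mellinConvergent_bSplineStar (hN : 1 ≤ N) (hV : ∀ v ∈ V, 0 < v) (hcard : V.card = N + 1)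
    {w : ℂ} (hw : 0 < w.re) :
    MellinConvergent (fun t => (bSplineStar N (insert 0 V) t : ℂ)) w := by
  have hcont : ContinuousOn (fun t => (bSplineStar N (insert 0 V) t : ℂ)) (Ioi 0) := by
    refine Complex.continuous_ofReal.comp_continuousOn ?_
    refine ContinuousOn.congr (f := fun t => (t ^ N)⁻¹ * (((N : ℝ) + 1) *
      ∑ v ∈ V, (max (v - t) 0) ^ N / (v * ∏ w ∈ V.erase v, (v - w)))) ?_
      fun t ht => bSplineStar_insert_zero hN hV ht
    refine ContinuousOn.mul (ContinuousOn.inv₀ (by fun_prop) fun t ht => ?_)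
      (by fun_prop)
    have : (0 : ℝ) < t := ht
    positivity
  -- The function vanishes beyond the largest knot, so any decay exponent above `w.re` would do;
  -- near zero it is constant.
  refine mellinConvergent_of_isBigO_rpow (a := w.re + 1) (b := 0)
    (hcont.locallyIntegrableOn measurableSet_Ioi) ?_ (by linarith) ?_ hw
  · refine Asymptotics.IsBigO.of_bound 0 ?_
    have h : ∀ᶠ t : ℝ in atTop, ∀ v ∈ V, v < t :=
      (Finset.eventually_all V).2 fun v _ => eventually_gt_atTop v
    filter_upwards [eventually_gt_atTop 0, h] with t ht hlt
    rw [bSplineStar_insert_zero hN hV ht, Finset.sum_eq_zero]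
    · simp
    · intro v hv
      rw [max_eq_right (sub_nonpos.2 (hlt v hv).le), zero_pow (by omega), zero_div]
  · refine Asymptotics.IsBigO.of_bound ‖((N : ℝ) + 1) / ∏ v ∈ V, v‖ ?_
    have h : ∀ᶠ t : ℝ in 𝓝[>] 0, ∀ v ∈ V, t < v :=
      (Finset.eventually_all V).2 fun v hv => mem_nhdsWithin_of_mem_nhds (Iio_mem_nhds (hV v hv))
    filter_upwards [self_mem_nhdsWithin, h] with t ht hlt
    rw [bSplineStar_eq_of_lt hN hV hcard ht hlt, neg_zero, Real.rpow_zero, norm_one, mul_one,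
      Complex.norm_real]

/-- Up to a constant, the integrand on `[0, v]` is the derivative of `((v - t) / (t + p))^(N+1)`.
This is why the kernel carries the exponent `N + 2`. -/
lemma integral_max_sub_pow_mul (N : ℕ) (hN : 1 ≤ N) {v p : ℝ} (hv : 0 < v) (hp : 0 < p) :
    IntegrableOn (fun t => (max (v - t) 0) ^ N * (p / (t + p) ^ (N + 2))) (Ioi 0) ∧
    ∫ t in Ioi 0, (max (v - t) 0) ^ N * (p / (t + p) ^ (N + 2)) =
      v ^ (N + 1) / (((N : ℝ) + 1) * (v + p) * p ^ N) := by
  set g : ℝ → ℝ := fun t => (max (v - t) 0) ^ N * (p / (t + p) ^ (N + 2)) with hg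
  have hzero : ∀ t ∈ Ioi (0 : ℝ) \ Ioc 0 v, g t = 0 := by
    intro t ht
    have h1 : v < t := by
      by_contra hcon
      exact ht.2 ⟨ht.1, not_lt.1 hcon⟩
    simp only [hg]
    rw [max_eq_right (sub_nonpos.2 h1.le), zero_pow (by omega), zero_mul]
  have hcont : ContinuousOn g (Icc 0 v) := by
    refine ContinuousOn.mul (by fun_prop) (ContinuousOn.div (by fun_prop) (by fun_prop) ?_)
    intro t ht
    have : (0 : ℝ) ≤ t := ht.1
    positivity
  have hIoc : IntegrableOn g (Ioc 0 v) := (hcont.integrableOn_Icc).mono_set Ioc_subset_Icc_self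
  refine ⟨hIoc.of_forall_sdiff_eq_zero measurableSet_Ioi hzero, ?_⟩
  rw [setIntegral_eq_of_subset_of_forall_sdiff_eq_zero measurableSet_Ioi Ioc_subset_Ioi_self hzero,
    ← intervalIntegral.integral_of_le hv.le]
  have hderiv : ∀ t ∈ uIcc 0 v, HasDerivAt
      (fun t => -(p / (((N : ℝ) + 1) * (v + p))) * ((v - t) / (t + p)) ^ (N + 1)) (g t) t := by
    intro t ht
    rw [uIcc_of_le hv.le] at ht
    have ht0 : 0 ≤ t := ht.1
    have htp : t + p ≠ 0 := by positivity
    have h1 : HasDerivAt (fun t : ℝ => (v - t) / (t + p))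
        (((-1) * (t + p) - (v - t) * 1) / (t + p) ^ 2) t :=
      ((hasDerivAt_id t).const_sub v).div ((hasDerivAt_id t).add_const p) htp
    have h2 := (h1.pow (N + 1)).const_mul (-(p / (((N : ℝ) + 1) * (v + p))))
    refine h2.congr_deriv ?_
    have hvp : v + p ≠ 0 := by positivity
    have hN1 : (N : ℝ) + 1 ≠ 0 := by positivity
    simp only [hg]
    rw [max_eq_left (sub_nonneg.2 ht.2), Nat.add_sub_cancel, div_pow]
    push_cast
    field_simp
    ring
  rw [intervalIntegral.integral_eq_sub_of_hasDerivAt hderiv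
    ((hcont.mono (by rw [uIcc_of_le hv.le])).intervalIntegrable)]
  have hvp : v + p ≠ 0 := by positivity
  have hN1 : (N : ℝ) + 1 ≠ 0 := by positivity
  rw [sub_self, zero_div, zero_pow (by omega), sub_zero, zero_add, div_pow, pow_succ p]
  field_simp
  ring

/-- After termwise integration the sum over knots is the partial fraction expansion of `z^N / ∏ (z -
v)` at `z = -p`. -/
lemma integral_bSplineStar_mul (hN : 1 ≤ N) (hV : ∀ v ∈ V, 0 < v) (hcard : V.card = N + 1) {p : ℝ}
    (hp : 0 < p) :
    ∫ t in Ioi 0, bSplineStar N (insert 0 V) t * (p / t * ((1 + p / t) ^ (N + 2))⁻¹) / t =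
      (∏ v ∈ V, (v + p))⁻¹ := by
  have h1 : ∫ t in Ioi 0,
      bSplineStar N (insert 0 V) t * (p / t * ((1 + p / t) ^ (N + 2))⁻¹) / t =
      ∫ t in Ioi 0, ∑ v ∈ V, (((N : ℝ) + 1) / (v * ∏ w ∈ V.erase v, (v - w))) *
        ((max (v - t) 0) ^ N * (p / (t + p) ^ (N + 2))) := by
    refine setIntegral_congr_fun measurableSet_Ioi fun t ht => ?_
    have ht : (0 : ℝ) < t := ht
    have e1 : 1 + p / t = (t + p) / t := by field_simp
    have e2 : (t ^ N)⁻¹ * (p / t * ((1 + p / t) ^ (N + 2))⁻¹) / t = p / (t + p) ^ (N + 2) := by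
      rw [e1, div_pow, inv_div, pow_add t]
      field_simp
    calc _ = (((N : ℝ) + 1) * ∑ v ∈ V, (max (v - t) 0) ^ N / (v * ∏ w ∈ V.erase v, (v - w))) *
          ((t ^ N)⁻¹ * (p / t * ((1 + p / t) ^ (N + 2))⁻¹) / t) := by
          rw [bSplineStar_insert_zero hN hV ht]; ring
      _ = _ := by
          rw [e2, Finset.mul_sum, Finset.sum_mul]
          exact Finset.sum_congr rfl fun v _ => by ring
  rw [h1, integral_finsetSum _ fun v hv =>
    ((integral_max_sub_pow_mul N hN (hV v hv) hp).1.integrable.const_mul _)]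
  have hpV : -p ∉ V := fun h => by linarith [hV _ h]
  have hdeg : ((X : ℝ[X]) ^ N).degree < V.card := by
    rw [degree_X_pow, hcard]
    exact_mod_cast N.lt_succ_self
  have h2 := sum_eval_div_prod_sub hdeg hpV
  have h3 : ∏ v ∈ V, (-p - v) = (-1) ^ (N + 1) * ∏ v ∈ V, (v + p) := by
    rw [← hcard, ← Finset.prod_const, ← Finset.prod_mul_distrib]
    exact Finset.prod_congr rfl fun v _ => by ring
  have hprod : (∏ v ∈ V, (v + p)) ≠ 0 :=
    Finset.prod_ne_zero_iff.2 fun v hv => (add_pos (hV v hv) hp).ne'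
  have h4 : (-p) ^ N = (-1) ^ N * p ^ N := by rw [← mul_pow, neg_one_mul]
  have h5 : ∀ v ∈ V, ∫ t in Ioi 0, (((N : ℝ) + 1) / (v * ∏ w ∈ V.erase v, (v - w))) *
      ((max (v - t) 0) ^ N * (p / (t + p) ^ (N + 2))) =
      -(p ^ N)⁻¹ * (((X : ℝ[X]) ^ N).eval v / ((∏ w ∈ V.erase v, (v - w)) * (-p - v))) := by
    intro v hv
    have hv0 := hV v hv
    have hvp : v + p ≠ 0 := by positivity
    have hvp' : -p - v = -(v + p) := by ring
    have hN1 : (N : ℝ) + 1 ≠ 0 := by positivity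
    have hd : (∏ w ∈ V.erase v, (v - w)) ≠ 0 :=
      Finset.prod_ne_zero_iff.2 fun w hw => sub_ne_zero.2 (Finset.ne_of_mem_erase hw).symm
    rw [integral_const_mul, (integral_max_sub_pow_mul N hN hv0 hp).2, hvp', pow_succ v]
    simp only [eval_pow, eval_X]
    field_simp
  rw [Finset.sum_congr rfl h5, ← Finset.mul_sum, h2, h3]
  simp only [eval_pow, eval_X]
  rw [h4, pow_succ]
  have h6 : ((-1 : ℝ)) ^ N ≠ 0 := by simp
  field_simp

/-- The rescaled B-spline is the multiplicative deconvolution of `∏ (1 + q / (b² v))⁻¹` by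
`q (1 + q / N) ^ (-N - 2)`. -/
lemma integral_scaled_bSplineStar_mul (hN : 1 ≤ N) (hV : ∀ v ∈ V, 0 < v) (hcard : V.card = N + 1)
    {b : ℝ} (hb : 0 < b) {q : ℝ} (hq : 0 < q) :
    ∫ t in Ioi 0, ((∏ v ∈ V, v) / N * bSplineStar N (insert 0 V) (N / b ^ 2 * t)) *
      (q / t * ((1 + q / t / N) ^ (N + 2))⁻¹) / t = (∏ v ∈ V, (1 + q * (b ^ 2 * v)⁻¹))⁻¹ := by
  have hN0 : (0 : ℝ) < N := by exact_mod_cast hN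
  set A : ℝ := N / b ^ 2 with hA
  have hA0 : 0 < A := by positivity
  -- With `A = N / b²` this gives `q / t / N = p / (A t)`, so the substitution `t ↦ A t` reduces to
  -- the unscaled identity.
  set p : ℝ := q / b ^ 2 with hp
  have hp0 : 0 < p := by positivity
  set g : ℝ → ℝ := fun t =>
    bSplineStar N (insert 0 V) t * (p / t * ((1 + p / t) ^ (N + 2))⁻¹) / t with hg
  have h1 : ∫ t in Ioi 0, ((∏ v ∈ V, v) / N * bSplineStar N (insert 0 V) (A * t)) *
      (q / t * ((1 + q / t / N) ^ (N + 2))⁻¹) / t =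
      ∫ t in Ioi 0, ((∏ v ∈ V, v) * A) * g (A * t) := by
    refine setIntegral_congr_fun measurableSet_Ioi fun t ht => ?_
    have ht : (0 : ℝ) < t := ht
    have e1 : q / t = N * (p / (A * t)) := by
      rw [hp, hA]
      field_simp
    have e2 : q / t / N = p / (A * t) := by rw [e1]; field_simp
    simp only [hg]
    rw [e2, e1]
    field_simp
  have h2 := integral_comp_mul_left_Ioi g 0 hA0
  rw [mul_zero, smul_eq_mul] at h2
  rw [h1, integral_const_mul, h2, integral_bSplineStar_mul hN hV hcard hp0, mul_assoc,
    mul_inv_cancel_left₀ hA0.ne', ← Finset.prod_inv_distrib, ← Finset.prod_mul_distrib,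
    ← Finset.prod_inv_distrib]
  refine Finset.prod_congr rfl fun v hv => ?_
  have hv0 := hV v hv
  have : 1 + q * (b ^ 2 * v)⁻¹ = (v + p) / v := by
    rw [hp]
    field_simp
  rw [this, inv_div]
  rfl

/-! ### Sums of independent exponential variables -/

/-- The coefficients of the distribution function of a sum of `n` independent exponential
variables with rates `a 0, …, a (n - 1)`. -/
def hypoexpCoeff (a : ℕ → ℝ) (n j : ℕ) : ℝ :=
  ∏ i ∈ (Finset.range n).erase j, a i / (a i - a j)

/-- The distribution function of a sum of `n` independent exponential variables with rates
`a 0, …, a (n - 1)`. -/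
def hypoexpCdf (a : ℕ → ℝ) (n : ℕ) (τ : ℝ) : ℝ :=
  1 - ∑ j ∈ Finset.range n, hypoexpCoeff a n j * Real.exp (-a j * τ)

section Hypoexponential

variable {a : ℕ → ℝ}

lemma hypoexpCoeff_succ (hinj : Function.Injective a) {n j : ℕ} (hj : j < n) :
    hypoexpCoeff a (n + 1) j * (a n - a j) = a n * hypoexpCoeff a n j := by
  have hne : a n - a j ≠ 0 := sub_ne_zero.2 fun h => hj.ne' (hinj h)
  rw [hypoexpCoeff, Finset.range_add_one, Finset.erase_insert_of_ne hj.ne', Finset.prod_insert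
    (fun h => Finset.notMem_range_self (Finset.mem_of_mem_erase h)), hypoexpCoeff]
  field_simp

/-- The coefficients are the Lagrange basis polynomials at the nodes `a j`, evaluated at 0, and
these polynomials sum to 1. -/
lemma sum_hypoexpCoeff (hinj : Function.Injective a) {n : ℕ} (hn : n ≠ 0) :
    ∑ j ∈ Finset.range n, hypoexpCoeff a n j = 1 := by
  have h1 := congrArg (Polynomial.eval 0)
    (Lagrange.sum_basis (s := Finset.range n) (v := a) hinj.injOn (by simpa using hn))
  rw [eval_finsetSum, eval_one] at h1
  rw [← h1]
  refine Finset.sum_congr rfl fun j _ => ?_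
  rw [hypoexpCoeff, Lagrange.basis, eval_prod]
  refine Finset.prod_congr rfl fun i hi => ?_
  have hne : a i - a j ≠ 0 := sub_ne_zero.2 fun h => (Finset.ne_of_mem_erase hi) (hinj h)
  have hne' : a j - a i ≠ 0 := by rwa [← neg_sub, neg_ne_zero] at hne
  simp only [Lagrange.basisDivisor, eval_mul, eval_C, eval_sub, eval_X]
  field_simp
  ring

lemma hypoexpCdf_zero (hinj : Function.Injective a) {n : ℕ} (hn : n ≠ 0) :
    hypoexpCdf a n 0 = 0 := by
  simp [hypoexpCdf, sum_hypoexpCoeff hinj hn]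

/-- In probabilistic terms, adding an exponential variable of rate `a n` convolves with its density,
which amounts to this linear equation. -/
lemma hasDerivAt_hypoexpCdf_succ (hinj : Function.Injective a) (n : ℕ) (τ : ℝ) :
    HasDerivAt (hypoexpCdf a (n + 1))
      (a n * (hypoexpCdf a n τ - hypoexpCdf a (n + 1) τ)) τ := by
  have h1 : HasDerivAt (hypoexpCdf a (n + 1))
      (-∑ j ∈ Finset.range (n + 1),
        hypoexpCoeff a (n + 1) j * (Real.exp (-a j * τ) * (-a j))) τ := by
    unfold hypoexpCdf
    refine HasDerivAt.const_sub 1 (HasDerivAt.fun_sum fun j _ => ?_)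
    have := ((hasDerivAt_id τ).const_mul (-a j)).exp
    simp only [id, mul_one] at this
    exact this.const_mul _
  refine h1.congr_deriv ?_
  simp only [hypoexpCdf, Finset.sum_range_succ]
  have h2 : ∑ j ∈ Finset.range n, hypoexpCoeff a (n + 1) j * (Real.exp (-a j * τ) * (-a j)) =
      ∑ j ∈ Finset.range n, a n * (hypoexpCoeff a n j * Real.exp (-a j * τ)) -
        ∑ j ∈ Finset.range n, a n * (hypoexpCoeff a (n + 1) j * Real.exp (-a j * τ)) := by
    rw [← Finset.sum_sub_distrib]
    refine Finset.sum_congr rfl fun j hj => ?_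
    have := hypoexpCoeff_succ hinj (Finset.mem_range.1 hj)
    linear_combination Real.exp (-a j * τ) * this
  rw [h2, ← Finset.mul_sum, ← Finset.mul_sum]
  ring

/-- With the integrating factor `exp (α τ)`, the derivative is nonnegative. Applied to the
distribution function and to its complement, this gives both bounds by induction without any sign
analysis of the alternating coefficients. -/
lemma nonneg_of_hasDerivAt_sub {α : ℝ} (hα : 0 < α) {f g : ℝ → ℝ}
    (hg : ∀ τ, 0 ≤ τ → 0 ≤ g τ) (hf0 : 0 ≤ f 0)
    (hf : ∀ τ, HasDerivAt f (α * (g τ - f τ)) τ) {τ : ℝ} (hτ : 0 ≤ τ) : 0 ≤ f τ := by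
  have hd : ∀ τ, HasDerivAt (fun τ => Real.exp (α * τ) * f τ)
      (α * Real.exp (α * τ) * g τ) τ := by
    intro τ
    have h1 := ((hasDerivAt_id τ).const_mul α).exp
    simp only [id, mul_one] at h1
    exact (h1.mul (hf τ)).congr_deriv (by ring)
  have hmono : MonotoneOn (fun τ => Real.exp (α * τ) * f τ) (Ici 0) := by
    refine monotoneOn_of_deriv_nonneg (convex_Ici 0)
      (fun τ _ => (hd τ).continuousAt.continuousWithinAt)
      (fun τ _ => (hd τ).differentiableAt.differentiableWithinAt) fun τ hτ => ?_
    rw [interior_Ici] at hτ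
    rw [(hd τ).deriv]
    have := hg τ (le_of_lt hτ)
    positivity
  have h := hmono self_mem_Ici hτ hτ
  simp only [mul_zero, Real.exp_zero, one_mul] at h
  exact nonneg_of_mul_nonneg_right (hf0.trans h) (Real.exp_pos _)

lemma hypoexpCdf_mem_Icc (ha : ∀ i, 0 < a i) (hinj : Function.Injective a) (n : ℕ) :
    ∀ τ, 0 ≤ τ → hypoexpCdf a n τ ∈ Icc (0 : ℝ) 1 := by
  induction n with
  | zero => intro τ _; simp [hypoexpCdf]
  | succ n ih =>
    intro τ hτ
    refine ⟨nonneg_of_hasDerivAt_sub (ha n) (fun τ hτ => (ih τ hτ).1)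
      (hypoexpCdf_zero hinj n.succ_ne_zero).ge (hasDerivAt_hypoexpCdf_succ hinj n) hτ, ?_⟩
    have h := nonneg_of_hasDerivAt_sub (ha n) (f := fun τ => 1 - hypoexpCdf a (n + 1) τ)
      (g := fun τ => 1 - hypoexpCdf a n τ) (fun τ hτ => sub_nonneg.2 (ih τ hτ).2)
      (by simp [hypoexpCdf_zero hinj n.succ_ne_zero])
      (fun τ => ((hasDerivAt_hypoexpCdf_succ hinj n τ).const_sub 1).congr_deriv (by ring)) hτ
    exact sub_nonneg.1 h

/-- This is the Laplace transform of the sum of `n` exponential variables, `∏ a j / (q + a j)`; the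
left side comes from integrating the distribution function term by term. -/
lemma one_sub_sum_hypoexpCoeff_mul (ha : ∀ i, 0 < a i) (hinj : Function.Injective a) {q : ℝ}
    (hq : 0 < q) (n : ℕ) :
    1 - ∑ j ∈ Finset.range n, hypoexpCoeff a n j * (q / (q + a j)) =
      (∏ j ∈ Finset.range n, (1 + q * (a j)⁻¹))⁻¹ := by
  induction n with
  | zero => simp
  | succ n ih =>
    have han := ha n
    have h1 : 1 + q * (a n)⁻¹ = (q + a n) / a n := by field_simp; ring
    have h2 : (q + a n) * ∑ j ∈ Finset.range (n + 1), hypoexpCoeff a (n + 1) j * (q / (q + a j)) =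
        q + a n * ∑ j ∈ Finset.range n, hypoexpCoeff a n j * (q / (q + a j)) := by
      have h3 : ∀ j ∈ Finset.range n,
          (q + a n) * (hypoexpCoeff a (n + 1) j * (q / (q + a j))) =
          q * hypoexpCoeff a (n + 1) j + a n * (hypoexpCoeff a n j * (q / (q + a j))) := by
        intro j hj
        have h4 := hypoexpCoeff_succ hinj (Finset.mem_range.1 hj)
        have haj := ha j
        have h5 : q + a j ≠ 0 := by positivity
        field_simp
        linear_combination h4
      rw [Finset.sum_range_succ, mul_add, Finset.mul_sum, Finset.sum_congr rfl h3,
        Finset.sum_add_distrib, ← Finset.mul_sum, ← Finset.mul_sum]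
      have h6 := sum_hypoexpCoeff hinj n.succ_ne_zero
      rw [Nat.succ_eq_add_one, Finset.sum_range_succ] at h6
      have h7 : q + a n ≠ 0 := by positivity
      have h8 : (q + a n) * (hypoexpCoeff a (n + 1) n * (q / (q + a n))) =
          q * hypoexpCoeff a (n + 1) n := by field_simp
      rw [h8]
      linear_combination q * h6
    rw [Finset.prod_range_succ, mul_inv, ← ih, h1, inv_div]
    have h7 : q + a n ≠ 0 := by positivity
    rw [← mul_div_assoc, eq_div_iff h7]
    linear_combination -h2

/-- The substitution `τ = 1/t` reduces this to the integral of `exp (-c τ)`. -/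
lemma integral_exp_neg_div_div_sq {c : ℝ} (hc : 0 < c) :
    IntegrableOn (fun t : ℝ => Real.exp (-c * t⁻¹) / t ^ 2) (Ioi 0) ∧
      ∫ t in Ioi (0 : ℝ), Real.exp (-c * t⁻¹) / t ^ 2 = c⁻¹ := by
  have hcongr : ∀ t ∈ Ioi (0 : ℝ),
      (|(-1 : ℝ)| * t ^ ((-1 : ℝ) - 1)) • Real.exp (-c * t ^ (-1 : ℝ)) =
        Real.exp (-c * t⁻¹) / t ^ 2 := by
    intro t ht
    have ht : (0 : ℝ) < t := ht
    have h2 : (-1 : ℝ) - 1 = -((2 : ℕ) : ℝ) := by norm_num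
    rw [h2, Real.rpow_neg ht.le, Real.rpow_natCast, Real.rpow_neg_one, abs_neg, abs_one, one_mul,
      smul_eq_mul, div_eq_inv_mul]
  constructor
  · refine IntegrableOn.congr_fun ?_ hcongr measurableSet_Ioi
    rw [integrableOn_Ioi_comp_rpow_iff (fun τ : ℝ => Real.exp (-c * τ)) (by norm_num)]
    exact integrableOn_exp_mul_Ioi (neg_lt_zero.2 hc) 0
  · rw [← setIntegral_congr_fun measurableSet_Ioi hcongr,
      integral_comp_rpow_Ioi (fun τ : ℝ => Real.exp (-c * τ)) (by norm_num),
      integral_exp_mul_Ioi (neg_lt_zero.2 hc)]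
    simp

lemma exp_mul_kernel_eq {q t : ℝ} (r : ℝ) (ht : 0 < t) :
    Real.exp (-r * t⁻¹) * (q / t * (Real.exp (q / t))⁻¹) / t =
      q * (Real.exp (-(q + r) * t⁻¹) / t ^ 2) := by
  have h : -(q + r) * t⁻¹ = -r * t⁻¹ + -(q / t) := by ring
  rw [h, Real.exp_add, Real.exp_neg (q / t)]
  field_simp

lemma integral_exp_mul_kernel {q r : ℝ} (hq : 0 < q) (hr : 0 ≤ r) :
    IntegrableOn (fun t => Real.exp (-r * t⁻¹) * (q / t * (Real.exp (q / t))⁻¹) / t) (Ioi 0) ∧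
      ∫ t in Ioi 0, Real.exp (-r * t⁻¹) * (q / t * (Real.exp (q / t))⁻¹) / t = q / (q + r) := by
  obtain ⟨h1, h2⟩ := integral_exp_neg_div_div_sq (c := q + r) (by positivity)
  constructor
  · exact IntegrableOn.congr_fun (h1.const_mul q) (fun t ht => (exp_mul_kernel_eq r ht).symm)
      measurableSet_Ioi
  · rw [setIntegral_congr_fun measurableSet_Ioi fun t ht => exp_mul_kernel_eq r ht,
      integral_const_mul, h2, div_eq_mul_inv]

lemma integral_hypoexpCdf_mul_kernel (ha : ∀ i, 0 < a i) (hinj : Function.Injective a) {q : ℝ}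
    (hq : 0 < q) (n : ℕ) :
    ∫ t in Ioi 0, hypoexpCdf a n t⁻¹ * (q / t * (Real.exp (q / t))⁻¹) / t =
      (∏ j ∈ Finset.range n, (1 + q * (a j)⁻¹))⁻¹ := by
  have h1 : ∀ t ∈ Ioi (0 : ℝ), hypoexpCdf a n t⁻¹ * (q / t * (Real.exp (q / t))⁻¹) / t =
      Real.exp (-0 * t⁻¹) * (q / t * (Real.exp (q / t))⁻¹) / t -
      ∑ j ∈ Finset.range n, hypoexpCoeff a n j *
        (Real.exp (-a j * t⁻¹) * (q / t * (Real.exp (q / t))⁻¹) / t) := by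
    intro t _
    rw [hypoexpCdf, neg_zero, zero_mul, Real.exp_zero, one_mul, sub_mul, sub_div, one_mul,
      Finset.sum_mul, Finset.sum_div]
    congr 1
    exact Finset.sum_congr rfl fun j _ => by ring
  have hi : ∀ j ∈ Finset.range n, Integrable (fun t => hypoexpCoeff a n j *
      (Real.exp (-a j * t⁻¹) * (q / t * (Real.exp (q / t))⁻¹) / t)) (volume.restrict (Ioi 0)) :=
    fun j _ => (integral_exp_mul_kernel hq (ha j).le).1.integrable.const_mul _
  rw [setIntegral_congr_fun measurableSet_Ioi h1,
    integral_sub (integral_exp_mul_kernel hq le_rfl).1 (integrable_finsetSum _ hi),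
    (integral_exp_mul_kernel hq le_rfl).2, integral_finsetSum _ hi, add_zero, div_self hq.ne',
    ← one_sub_sum_hypoexpCoeff_mul ha hinj hq]
  congr 1
  refine Finset.sum_congr rfl fun j _ => ?_
  rw [integral_const_mul, (integral_exp_mul_kernel hq (ha j).le).2]

lemma tendsto_hypoexpCdf {c : ℕ → ℝ} {M : ℝ}
    (hc : ∀ j, Tendsto (fun n => hypoexpCoeff a n j) atTop (𝓝 (c j)))
    (hM : ∀ n j, j < n → |hypoexpCoeff a n j| ≤ M) {τ : ℝ}
    (hsum : Summable fun j => Real.exp (-a j * τ)) :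
    Tendsto (fun n => hypoexpCdf a n τ) atTop
      (𝓝 (1 - ∑' j, c j * Real.exp (-a j * τ))) := by
  have h1 := tendsto_tsum_of_dominated_convergence (𝓕 := atTop)
    -- Extending the finite sums by zero makes them series over all `j`, dominated by `M * exp (-a j
    -- * τ)`.
    (f := fun n j => if j < n then hypoexpCoeff a n j * Real.exp (-a j * τ) else 0)
    (g := fun j => c j * Real.exp (-a j * τ)) (bound := fun j => M * Real.exp (-a j * τ))
    (hsum.mul_left M) ?_ ?_
  · refine (h1.const_sub 1).congr fun n => ?_
    rw [hypoexpCdf, tsum_eq_sum (s := Finset.range n)]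
    · congr 1
      exact Finset.sum_congr rfl fun j hj => if_pos (Finset.mem_range.1 hj)
    · intro j hj
      exact if_neg fun h => hj (Finset.mem_range.2 h)
  · intro j
    refine ((hc j).mul_const _).congr' ?_
    filter_upwards [eventually_gt_atTop j] with n hn
    rw [if_pos hn]
  · refine Eventually.of_forall fun n j => ?_
    split_ifs with h
    · rw [norm_mul, Real.norm_eq_abs, Real.norm_of_nonneg (Real.exp_pos _).le]
      exact mul_le_mul_of_nonneg_right (hM n j h) (Real.exp_pos _).le
    · rw [norm_zero]
      have := (abs_nonneg _).trans (hM (j + 1) j j.lt_succ_self)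
      positivity

/-! ### The limiting kernel `q e^(-q)` and the infinite sum of exponential variables -/

lemma mellinConvergent_gammaKernel {w : ℂ} (hw : 0 < w.re) :
    MellinConvergent (fun q : ℝ => ((q * (Real.exp q)⁻¹ : ℝ) : ℂ)) w := by
  have h : 0 < (w + 1).re := by simp; linarith
  refine IntegrableOn.congr_fun (Complex.GammaIntegral_convergent h) (fun q hq => ?_)
    measurableSet_Ioi
  have hq : (q : ℂ) ≠ 0 := by exact_mod_cast (show (0 : ℝ) < q from hq).ne'
  simp only [smul_eq_mul, add_sub_cancel_right, Real.exp_neg]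
  rw [Complex.cpow_sub _ _ hq, Complex.cpow_one]
  push_cast
  field_simp

lemma mellin_gammaKernel {w : ℂ} (hw : 0 < w.re) :
    mellin (fun q : ℝ => ((q * (Real.exp q)⁻¹ : ℝ) : ℂ)) w = Complex.Gamma (w + 1) := by
  have h : 0 < (w + 1).re := by simp; linarith
  rw [Complex.Gamma_eq_integral h]
  refine setIntegral_congr_fun measurableSet_Ioi fun q hq => ?_
  have hq : (q : ℂ) ≠ 0 := by exact_mod_cast (show (0 : ℝ) < q from hq).ne'
  simp only [smul_eq_mul, add_sub_cancel_right, Real.exp_neg]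
  rw [Complex.cpow_sub _ _ hq, Complex.cpow_one]
  push_cast
  field_simp

lemma integral_rpow_mul_gammaKernel_pos {σ : ℝ} (hσ : 0 < σ) :
    0 < ∫ q in Ioi (0 : ℝ), q ^ (σ - 1) * (q * (Real.exp q)⁻¹) := by
  have h : ∫ q in Ioi (0 : ℝ), q ^ (σ - 1) * (q * (Real.exp q)⁻¹) = Real.Gamma (σ + 1) := by
    rw [Real.Gamma_eq_integral (by linarith)]
    refine setIntegral_congr_fun measurableSet_Ioi fun q hq => ?_
    have hq : (0 : ℝ) < q := hq
    simp only [add_sub_cancel_right, Real.exp_neg]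
    rw [Real.rpow_sub_one hq.ne']
    field_simp
  rw [h]
  exact Real.Gamma_pos_of_pos (by linarith)

/-- The Mellin transform of the distribution function (in the variable `1 / t`) of an infinite sum
of independent exponential variables whose Laplace transform is `1 / C`. -/
theorem hasMellin_of_tendsto_hypoexpCoeff (ha : ∀ i, 0 < a i) (hinj : Function.Injective a)
    {c : ℕ → ℝ} {M : ℝ} (hc : ∀ j, Tendsto (fun n => hypoexpCoeff a n j) atTop (𝓝 (c j)))
    (hM : ∀ n j, j < n → |hypoexpCoeff a n j| ≤ M)
    (hsum : ∀ τ, 0 < τ → Summable fun j => Real.exp (-a j * τ)) {C : ℝ → ℝ}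
    (hlim : ∀ q, 0 < q → Tendsto (fun n => ∏ j ∈ Finset.range n, (1 + q * (a j)⁻¹)) atTop
      (𝓝 (C q)))
    (hC : ∀ M : ℝ, ∃ q, 0 < q ∧ M * C q < C (4 * q)) {f : ℝ → ℝ} (hf : Measurable f)
    (hfeq : ∀ t, 0 < t → f t = 1 - ∑' j, c j * Real.exp (-a j * t⁻¹)) {w : ℂ} (hw : 0 < w.re) :
    HasMellin (fun t => (f t : ℂ)) w
      (mellin (fun q => ((C q)⁻¹ : ℝ) : ℝ → ℂ) w / Complex.Gamma (w + 1)) := by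
  have hptw : ∀ t, 0 < t → Tendsto (fun n => hypoexpCdf a n t⁻¹) atTop (𝓝 (f t)) := by
    intro t ht
    rw [hfeq t ht]
    exact tendsto_hypoexpCdf hc hM (hsum _ (inv_pos.2 ht))
  -- The bounds pass to the limit from the finite sums. Nonnegativity of `f` is what permits the
  -- Tonelli argument below.
  have hmem : ∀ t, 0 < t → f t ∈ Icc (0 : ℝ) 1 := fun t ht =>
    isClosed_Icc.mem_of_tendsto (hptw t ht)
      (Eventually.of_forall fun n => hypoexpCdf_mem_Icc ha hinj n _ (inv_pos.2 ht).le)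
  have hk : Measurable fun q : ℝ => q * (Real.exp q)⁻¹ := by fun_prop
  have hC1 : ∀ q, 0 < q → 1 ≤ C q := fun q hq => ge_of_tendsto (hlim q hq)
    (Eventually.of_forall fun n => one_le_prod_one_add _ (fun j _ => (inv_pos.2 (ha j)).le) hq)
  have hdom : ∀ q, 0 < q →
      IntegrableOn (fun t : ℝ => q / t * (Real.exp (q / t))⁻¹ / t) (Ioi 0) := by
    intro q hq
    simpa using (integral_exp_mul_kernel hq le_rfl).1
  have hbd : ∀ q t x : ℝ, 0 < q → 0 < t → x ∈ Icc (0 : ℝ) 1 →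
      ‖x * (q / t * (Real.exp (q / t))⁻¹) / t‖ ≤ q / t * (Real.exp (q / t))⁻¹ / t := by
    intro q t x hq ht hx
    have hx0 := hx.1
    rw [Real.norm_of_nonneg (by positivity), mul_div_assoc]
    exact mul_le_of_le_one_left (by positivity) hx.2
  have hsec : ∀ q, 0 < q →
      IntegrableOn (fun t => f t * (q / t * (Real.exp (q / t))⁻¹) / t) (Ioi 0) := by
    intro q hq
    refine Integrable.mono' (hdom q hq) (Measurable.aestronglyMeasurable (by fun_prop)) ?_
    filter_upwards [ae_restrict_mem measurableSet_Ioi] with t ht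
    exact hbd q t _ hq ht (hmem t ht)
  have hconv : ∀ q, 0 < q →
      ∫ t in Ioi 0, f t * (q / t * (Real.exp (q / t))⁻¹) / t = (C q)⁻¹ := by
    intro q hq
    have h1 : Tendsto (fun n => ∫ t in Ioi 0,
        hypoexpCdf a n t⁻¹ * (q / t * (Real.exp (q / t))⁻¹) / t) atTop
        (𝓝 (∫ t in Ioi 0, f t * (q / t * (Real.exp (q / t))⁻¹) / t)) := by
      refine tendsto_integral_of_dominated_convergence
        (fun t => q / t * (Real.exp (q / t))⁻¹ / t) ?_ (hdom q hq) ?_ ?_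
      · intro n
        unfold hypoexpCdf
        exact Measurable.aestronglyMeasurable (by fun_prop)
      · intro n
        filter_upwards [ae_restrict_mem measurableSet_Ioi] with t ht
        exact hbd q t _ hq ht
          (hypoexpCdf_mem_Icc ha hinj n _ (inv_pos.2 (show (0 : ℝ) < t from ht)).le)
      · filter_upwards [ae_restrict_mem measurableSet_Ioi] with t ht
        exact ((hptw t ht).mul_const _).div_const _
    simp only [integral_hypoexpCdf_mul_kernel ha hinj hq] at h1
    exact tendsto_nhds_unique h1 ((hlim q hq).inv₀ (zero_lt_one.trans_le (hC1 q hq)).ne')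
  have hCint := (tendsto_integral_abs_inv_prod_sub (s := Finset.range) (y := fun _ j => (a j)⁻¹)
    (Eventually.of_forall fun n j _ => (inv_pos.2 (ha j)).le) hlim hC hw).2.1
  have hconvergent : MellinConvergent (fun t => (f t : ℂ)) w :=
    mellinConvergent_of_conv hf hk (fun t ht => (hmem t ht).1) (fun t ht => by positivity)
      (integral_rpow_mul_gammaKernel_pos hw) hsec hconv hCint
  refine ⟨hconvergent, ?_⟩
  rw [mellin_eq_mul_of_conv hf hk hconvergent (mellinConvergent_gammaKernel hw) hconv,
    mellin_gammaKernel hw, mul_div_cancel_right₀]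
  exact Complex.Gamma_ne_zero_of_re_pos (by simp; linarith)

end Hypoexponential

/-! ### Coefficients for the rates `(π (i + e / 2))²` -/

lemma prod_telescope {x : ℝ} (hx : 0 < x) (m : ℕ) :
    ∏ i ∈ Finset.range m, ((x + 1 + i) / (x + i)) = (x + m) / x := by
  induction m with
  | zero => simp [hx.ne']
  | succ m ih =>
    rw [Finset.prod_range_succ, ih]
    have : x + m ≠ 0 := by positivity
    field_simp
    push_cast
    ring

lemma prod_add_one_div_sub (j : ℕ) : ∏ i ∈ Finset.range j, (((i : ℝ) + 1) / (j - i)) = 1 := by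
  have h : ∏ i ∈ Finset.range j, ((j : ℝ) - i) = ∏ i ∈ Finset.range j, ((i : ℝ) + 1) := by
    rw [← Finset.prod_range_reflect]
    refine Finset.prod_congr rfl fun i hi => ?_
    have hi : i < j := Finset.mem_range.1 hi
    rw [Nat.sub_sub, Nat.cast_sub (by omega)]
    push_cast
    ring
  rw [Finset.prod_div_distrib, h, div_self]
  exact Finset.prod_ne_zero_iff.2 fun i _ => by positivity

/-- The product `∏_{i < j} (n - 1 - i) / (n + e + i)`. -/
def decayFactor (e : ℝ) (n j : ℕ) : ℝ :=
  ∏ i ∈ Finset.range j, (((n : ℝ) - 1 - i) / (n + e + i))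

lemma decayFactor_succ {e : ℝ} (he : 0 < e) (n j : ℕ) :
    decayFactor e (n + 1) j * ((n - j) * (n + e + j)) = n * (n + e) * decayFactor e n j := by
  induction j with
  | zero => simp [decayFactor]
  | succ j ih =>
    have hsucc : ∀ m : ℕ, decayFactor e m (j + 1) =
        decayFactor e m j * (((m : ℝ) - 1 - j) / (m + e + j)) := fun m =>
      Finset.prod_range_succ _ _
    rw [hsucc, hsucc]
    have h1 : (n : ℝ) + e + j ≠ 0 := by positivity
    have h2 : (((n + 1 : ℕ) : ℝ) + e + j) ≠ 0 := by positivity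
    have h3 : ((n + 1 : ℕ) : ℝ) = n + 1 := by push_cast; ring
    rw [h3] at h2 ⊢
    have h4 : ((j + 1 : ℕ) : ℝ) = j + 1 := by push_cast; ring
    rw [h4]
    calc _ = (decayFactor e (n + 1) j * ((n - j) * (n + e + j))) * ((n - 1 - j) / (n + e + j)) := by
          field_simp
          ring
      _ = _ := by rw [ih]; ring

lemma decayFactor_mem_Icc {e : ℝ} (he : 0 < e) {n j : ℕ} (hj : j < n) :
    decayFactor e n j ∈ Icc (0 : ℝ) 1 := by
  have h : ∀ i ∈ Finset.range j, 0 ≤ ((n : ℝ) - 1 - i) / (n + e + i) ∧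
      ((n : ℝ) - 1 - i) / (n + e + i) ≤ 1 := by
    intro i hi
    have h1 : ((i : ℝ) + 1) ≤ n := by
      exact_mod_cast (Nat.succ_le_of_lt ((Finset.mem_range.1 hi).trans hj))
    constructor
    · exact div_nonneg (by linarith) (by positivity)
    · rw [div_le_one (by positivity)]
      have : (0 : ℝ) ≤ i := by positivity
      linarith
  exact ⟨Finset.prod_nonneg fun i hi => (h i hi).1,
    Finset.prod_le_one (fun i hi => (h i hi).1) fun i hi => (h i hi).2⟩

lemma tendsto_natCast_add_div (x y : ℝ) :
    Tendsto (fun n : ℕ => ((n : ℝ) + x) / (n + y)) atTop (𝓝 1) := by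
  have h : ∀ z : ℝ, Tendsto (fun n : ℕ => 1 + z * ((n : ℝ))⁻¹) atTop (𝓝 1) := fun z => by
    simpa using ((tendsto_inv_atTop_nhds_zero_nat (𝕜 := ℝ)).const_mul z).const_add 1
  have h1 := (h x).div (h y) one_ne_zero
  rw [div_one] at h1
  refine h1.congr' ?_
  filter_upwards [eventually_gt_atTop 0] with n hn
  have hn : (n : ℝ) ≠ 0 := by positivity
  have e1 : ∀ z : ℝ, 1 + z * (n : ℝ)⁻¹ = (n + z) / n := fun z => by field_simp
  simp only [Pi.div_apply]
  rw [e1, e1, div_div_div_cancel_right₀ hn]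

lemma tendsto_decayFactor (e : ℝ) (j : ℕ) :
    Tendsto (fun n => decayFactor e n j) atTop (𝓝 1) := by
  have : ∀ i ∈ Finset.range j,
      Tendsto (fun n : ℕ => ((n : ℝ) - 1 - i) / (n + e + i)) atTop (𝓝 1) := fun i _ => by
    refine (tendsto_natCast_add_div (-1 - i) (e + i)).congr fun n => ?_
    congr 1 <;> ring
  have h := tendsto_finsetProd _ this
  rwa [Finset.prod_const_one] at h

section Coeff

variable {a : ℕ → ℝ} {e s : ℝ} {c₀ B : ℕ → ℝ}

/-- Passing from `n` to `n + 1` multiplies the coefficient by `a n / (a n - a j)`, and `a n - a j =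
s² (n - j)(n + e + j)`. The ratio splits into one independent of `j`, carried by `c₀`, and one
carried by `decayFactor`. As `decayFactor` lies in `[0, 1]` for `j < n` and tends to 1, limits and
uniform bounds of the coefficients reduce to those of `c₀`. -/
lemma hypoexpCoeff_eq (he : 0 < e) (haeq : ∀ i, a i = s ^ 2 * (i + e / 2) ^ 2)
    (hinj : Function.Injective a)
    (hc₀ : ∀ n : ℕ, 1 ≤ n → c₀ (n + 1) * (n * (n + e)) = (n + e / 2) ^ 2 * c₀ n)
    (hbase : ∀ j, hypoexpCoeff a (j + 1) j = (-1) ^ j * B j * c₀ (j + 1) * decayFactor e (j + 1) j)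
    {n j : ℕ} (hj : j < n) :
    hypoexpCoeff a n j = (-1) ^ j * B j * c₀ n * decayFactor e n j := by
  induction n, hj using Nat.le_induction with
  | base => exact hbase j
  | succ n hn ih =>
    have hn : j < n := hn
    have h1 := hypoexpCoeff_succ hinj hn
    have h2 := hc₀ n (by omega)
    have h3 := decayFactor_succ he n j
    have hn0 : (0 : ℝ) < n := by exact_mod_cast (Nat.zero_le j).trans_lt hn
    have hd : a n - a j = s ^ 2 * ((n - j) * (n + e + j)) := by rw [haeq, haeq]; ring
    have hd0 : a n - a j ≠ 0 := sub_ne_zero.2 fun h => hn.ne' (hinj h)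
    apply mul_right_cancel₀ hd0
    rw [h1, ih, hd, haeq n]
    linear_combination (-(-1) ^ j * B j * s ^ 2 * c₀ (n + 1)) * h3 -
      (-1) ^ j * B j * s ^ 2 * decayFactor e n j * h2

lemma tendsto_hypoexpCoeff_of_eq {L : ℝ}
    (h : ∀ n j, j < n → hypoexpCoeff a n j = (-1) ^ j * B j * c₀ n * decayFactor e n j)
    (hL : Tendsto c₀ atTop (𝓝 L)) (j : ℕ) :
    Tendsto (fun n => hypoexpCoeff a n j) atTop (𝓝 ((-1) ^ j * B j * L)) := by
  have h1 := (hL.const_mul ((-1) ^ j * B j)).mul (tendsto_decayFactor e j)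
  rw [mul_one] at h1
  refine h1.congr' ?_
  filter_upwards [eventually_gt_atTop j] with n hn
  rw [h n j hn]

lemma abs_hypoexpCoeff_le_of_eq {M : ℝ} (he : 0 < e)
    (h : ∀ n j, j < n → hypoexpCoeff a n j = (-1) ^ j * B j * c₀ n * decayFactor e n j)
    (hB : ∀ j, |B j| ≤ 1) (hM : ∀ n, |c₀ n| ≤ M) {n j : ℕ} (hj : j < n) :
    |hypoexpCoeff a n j| ≤ M := by
  have hd := decayFactor_mem_Icc he hj
  rw [h n j hj, abs_mul, abs_mul, abs_mul, abs_pow, abs_neg, abs_one, one_pow, one_mul,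
    abs_of_nonneg hd.1]
  have h1 : |B j| * |c₀ n| ≤ 1 * M := mul_le_mul (hB j) (hM n) (abs_nonneg _) zero_le_one
  have h2 : |B j| * |c₀ n| * decayFactor e n j ≤ |B j| * |c₀ n| * 1 :=
    mul_le_mul_of_nonneg_left hd.2 (by positivity)
  linarith

lemma summable_exp_neg_of_eq (hs : 0 < s) (he : 0 < e)
    (haeq : ∀ i, a i = s ^ 2 * (i + e / 2) ^ 2) {τ : ℝ} (hτ : 0 < τ) :
    Summable fun j => Real.exp (-a j * τ) := by
  -- A geometric series dominates because `(j + e/2)² ≥ e j`.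
  have h1 : Summable fun j : ℕ => Real.exp (-(s ^ 2 * e * τ)) ^ j :=
    summable_geometric_of_lt_one (Real.exp_pos _).le
      (by rw [Real.exp_lt_one_iff, neg_lt_zero]; positivity)
  refine Summable.of_nonneg_of_le (fun _ => (Real.exp_pos _).le) (fun j => ?_) h1
  rw [← Real.exp_nat_mul]
  refine Real.exp_le_exp.2 ?_
  have h2 : 0 ≤ s ^ 2 * τ * ((j : ℝ) ^ 2 + (e / 2) ^ 2) := by positivity
  rw [haeq]
  nlinarith

end Coeff

/-! ### The theta-like functions -/

/-- The squared zeros of `cos` (`d = 0`) and of `sin z / z` (`d = 1`). -/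
def expRate (d i : ℕ) : ℝ := Real.pi ^ 2 * ((i : ℝ) + ((d : ℝ) + 1) / 2) ^ 2

/-- `cosh √q` for `d = 0` and `sinh √q / √q` for `d = 1`. -/
def limitProduct (d : ℕ) (q : ℝ) : ℝ :=
  if d = 0 then Real.cosh √q else Real.sinh √q / √q

lemma expRate_pos (d i : ℕ) : 0 < expRate d i := by
  unfold expRate
  positivity

lemma expRate_injective (d : ℕ) : Function.Injective (expRate d) := by
  intro i j h
  have h1 := mul_left_cancel₀ (by positivity) h
  have h2 := (pow_left_inj₀ (by positivity) (by positivity) two_ne_zero).1 h1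
  exact_mod_cast add_right_cancel h2

lemma expRate_div_sub (d i j : ℕ) :
    expRate d i / (expRate d i - expRate d j) =
      ((i : ℝ) + ((d : ℝ) + 1) / 2) ^ 2 / (((i : ℝ) - j) * (i + j + (d + 1))) := by
  have h1 : expRate d i - expRate d j =
      Real.pi ^ 2 * (((i : ℝ) - j) * (i + j + (d + 1))) := by unfold expRate; ring
  rw [h1, expRate, mul_div_mul_left _ _ (by positivity)]

lemma range_succ_erase_self (j : ℕ) : (Finset.range (j + 1)).erase j = Finset.range j := by
  rw [Finset.range_add_one, Finset.erase_insert Finset.notMem_range_self]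

lemma hypoexpCoeff_expRate_self (d j : ℕ) :
    hypoexpCoeff (expRate d) (j + 1) j = ∏ i ∈ Finset.range j,
      (((i : ℝ) + ((d : ℝ) + 1) / 2) ^ 2 / (((i : ℝ) - j) * (i + j + (d + 1)))) := by
  rw [hypoexpCoeff, range_succ_erase_self]
  exact Finset.prod_congr rfl fun i _ => expRate_div_sub d i j

lemma hypoexpCoeff_expRate_one {n j : ℕ} (hj : j < n) :
    hypoexpCoeff (expRate 1) n j =
      (-1) ^ j * 1 * (2 * n / (n + 1)) * decayFactor 2 n j := by
  refine hypoexpCoeff_eq (s := Real.pi) (e := 2) (B := fun _ => 1)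
    (c₀ := fun n : ℕ => 2 * (n : ℝ) / (n + 1)) (by norm_num)
    (fun i => by norm_num [expRate]) (expRate_injective 1) (fun n hn => ?_) (fun j => ?_) hj
  · have : (n : ℝ) + 1 + 1 ≠ 0 := by positivity
    push_cast
    field_simp
    ring
  · have hsplit : hypoexpCoeff (expRate 1) (j + 1) j =
        ∏ i ∈ Finset.range j, ((-1) * ((((j + 1 : ℕ) : ℝ) - 1 - i) / ((j + 1 : ℕ) + 2 + i)) *
          (((i : ℝ) + 1) / (j - i)) * (((i : ℝ) + 1) / (j - i)) *
          (((j : ℝ) + 2 + 1 + i) / (j + 2 + i))) := by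
      rw [hypoexpCoeff_expRate_self]
      refine Finset.prod_congr rfl fun i hi => ?_
      have h1 : (i : ℝ) < j := by exact_mod_cast Finset.mem_range.1 hi
      have h2 : (j : ℝ) - i ≠ 0 := by linarith
      have h3 : (i : ℝ) - j = -(j - i) := by ring
      have h4 : (j : ℝ) + 2 + 1 + i ≠ 0 := by positivity
      have h5 : (j : ℝ) + 2 + i ≠ 0 := by positivity
      have h6 : (i : ℝ) + j + ((1 : ℕ) + 1) = j + 2 + i := by push_cast; ring
      have h7 : (((j + 1 : ℕ) : ℝ)) + 2 + i = j + 2 + 1 + i := by push_cast; ring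
      have h8 : (((j + 1 : ℕ) : ℝ)) - 1 - i = j - i := by push_cast; ring
      rw [h3, h6, h7, h8]
      push_cast
      field_simp
      ring
    rw [hsplit]
    simp only [Finset.prod_mul_distrib]
    rw [prod_add_one_div_sub, prod_telescope (by positivity), Finset.prod_const,
      Finset.card_range, ← decayFactor]
    have : (j : ℝ) + 2 ≠ 0 := by positivity
    push_cast
    field_simp
    ring

lemma hypoexpCoeff_expRate_zero {n j : ℕ} (hj : j < n) :
    hypoexpCoeff (expRate 0) n j =
      (-1) ^ j * (1 / (2 * (j : ℝ) + 1)) *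
        ((2 * n - 1) / (n * Real.Wallis.W (n - 1))) * decayFactor 1 n j := by
  refine hypoexpCoeff_eq (s := Real.pi) (e := 1) (B := fun j => 1 / (2 * (j : ℝ) + 1))
    (c₀ := fun n : ℕ => (2 * (n : ℝ) - 1) / (n * Real.Wallis.W (n - 1))) (by norm_num)
    (fun i => by norm_num [expRate]) (expRate_injective 0) (fun n hn => ?_) (fun j => ?_) hj
  · obtain ⟨m, rfl⟩ : ∃ m, n = m + 1 := ⟨n - 1, by omega⟩
    have hW := (Real.Wallis.W_pos m).ne'
    simp only [Nat.add_sub_cancel, Real.Wallis.W_succ]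
    have h1 : (2 * (m : ℝ) + 1) ≠ 0 := by positivity
    have h2 : (2 * (m : ℝ) + 2) ≠ 0 := by positivity
    have h3 : (2 * (m : ℝ) + 3) ≠ 0 := by positivity
    have h4 : (m : ℝ) + 1 ≠ 0 := by positivity
    have h5 : (m : ℝ) + 1 + 1 ≠ 0 := by positivity
    push_cast
    field_simp
    ring
  · have hsplit : hypoexpCoeff (expRate 0) (j + 1) j * Real.Wallis.W j =
        ∏ i ∈ Finset.range j, ((-1) * ((((j + 1 : ℕ) : ℝ) - 1 - i) / ((j + 1 : ℕ) + 1 + i)) *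
          (((i : ℝ) + 1) / (j - i)) * (((i : ℝ) + 1) / (j - i)) *
          (((j : ℝ) + 1 + 1 + i) / (j + 1 + i)) *
          (((1 : ℝ) / 2 + 1 + i) / (1 / 2 + i))⁻¹) := by
      rw [hypoexpCoeff_expRate_self, Real.Wallis.W, ← Finset.prod_mul_distrib]
      refine Finset.prod_congr rfl fun i hi => ?_
      have h1 : (i : ℝ) < j := by exact_mod_cast Finset.mem_range.1 hi
      have h2 : (j : ℝ) - i ≠ 0 := by linarith
      have h3 : (i : ℝ) - j = -(j - i) := by ring
      have h4 : (j : ℝ) + 1 + 1 + i ≠ 0 := by positivity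
      have h5 : (j : ℝ) + 1 + i ≠ 0 := by positivity
      have h6 : (i : ℝ) + j + ((0 : ℕ) + 1) = j + 1 + i := by push_cast; ring
      have h7 : (((j + 1 : ℕ) : ℝ)) + 1 + i = j + 1 + 1 + i := by push_cast; ring
      have h8 : (((j + 1 : ℕ) : ℝ)) - 1 - i = j - i := by push_cast; ring
      have h9 : (i : ℝ) + (((0 : ℕ) : ℝ) + 1) / 2 = (2 * i + 1) / 2 := by push_cast; ring
      have h10 : (1 : ℝ) / 2 + i = (2 * i + 1) / 2 := by ring
      have h11 : (1 : ℝ) / 2 + 1 + i = (2 * i + 3) / 2 := by ring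
      have h12 : 2 * (i : ℝ) + 1 ≠ 0 := by positivity
      have h13 : 2 * (i : ℝ) + 3 ≠ 0 := by positivity
      rw [h3, h6, h7, h8, h9, h10, h11]
      field_simp
    have hW := (Real.Wallis.W_pos j).ne'
    apply mul_right_cancel₀ hW
    rw [hsplit]
    simp only [Finset.prod_mul_distrib, Finset.prod_inv_distrib]
    rw [prod_add_one_div_sub, prod_telescope (by positivity), prod_telescope (by positivity),
      Finset.prod_const, Finset.card_range, ← decayFactor]
    have h1 : (j : ℝ) + 1 ≠ 0 := by positivity
    have h2 : 2 * (j : ℝ) + 1 ≠ 0 := by positivity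
    have h3 : (1 : ℝ) / 2 + j = (2 * j + 1) / 2 := by ring
    rw [h3]
    simp only [Nat.add_sub_cancel]
    push_cast
    field_simp
    ring

lemma tendsto_two_mul_div : Tendsto (fun n : ℕ => 2 * (n : ℝ) / (n + 1)) atTop (𝓝 2) := by
  have h := (tendsto_natCast_add_div 0 1).const_mul 2
  rw [mul_one] at h
  exact h.congr fun n => by rw [add_zero, mul_div_assoc]

lemma tendsto_two_mul_sub_one_div_wallis :
    Tendsto (fun n : ℕ => (2 * (n : ℝ) - 1) / (n * Real.Wallis.W (n - 1))) atTop
      (𝓝 (4 / Real.pi)) := by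
  have h1 := (tendsto_natCast_add_div (-1 / 2) 0).const_mul 2
  have h2 := Real.Wallis.tendsto_W_nhds_pi_div_two.comp (tendsto_sub_atTop_nat 1)
  have h3 := h1.div h2 (by positivity)
  have h4 : 2 * 1 / (Real.pi / 2) = 4 / Real.pi := by field_simp; norm_num
  rw [h4] at h3
  refine h3.congr fun n => ?_
  simp only [Function.comp, Pi.div_apply, add_zero]
  rw [mul_div_assoc', div_div]
  congr 1
  ring

/-! ### Euler products -/

lemma tendsto_prod_expRate_one {q : ℝ} (hq : 0 < q) :
    Tendsto (fun n => ∏ j ∈ Finset.range n, (1 + q * (expRate 1 j)⁻¹)) atTop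
      (𝓝 (limitProduct 1 q)) := by
  have hs : 0 < √q := Real.sqrt_pos.2 hq
  have hpi : (Real.pi : ℂ) ≠ 0 := by exact_mod_cast Real.pi_ne_zero
  have hs0 : (√q : ℂ) ≠ 0 := by exact_mod_cast hs.ne'
  have h1 := Complex.tendsto_euler_sin_prod (√q * Complex.I / Real.pi)
  rw [mul_div_cancel₀ _ hpi, Complex.sin_mul_I] at h1
  have h2 := h1.div_const (√q * Complex.I)
  rw [mul_div_mul_right _ _ Complex.I_ne_zero] at h2
  have h3 : Complex.sinh √q / √q = ((limitProduct 1 q : ℝ) : ℂ) := by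
    rw [limitProduct, if_neg one_ne_zero]
    push_cast
    rfl
  rw [h3] at h2
  have h4 := (Complex.continuous_re.tendsto _).comp h2
  rw [Complex.ofReal_re] at h4
  refine h4.congr fun n => ?_
  have h5 : ∏ j ∈ Finset.range n,
      (1 - (√q * Complex.I / Real.pi) ^ 2 / ((j : ℂ) + 1) ^ 2) =
      ((∏ j ∈ Finset.range n, (1 + q * (expRate 1 j)⁻¹) : ℝ) : ℂ) := by
    rw [Complex.ofReal_prod]
    refine Finset.prod_congr rfl fun j _ => ?_
    have h6 : (√q : ℂ) ^ 2 = q := by exact_mod_cast Real.sq_sqrt hq.le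
    have h7 : expRate 1 j = Real.pi ^ 2 * ((j : ℝ) + 1) ^ 2 := by norm_num [expRate]
    rw [h7, div_pow, mul_pow, h6, Complex.I_sq]
    push_cast
    rw [mul_neg_one, neg_div, neg_div, sub_neg_eq_add, div_div, div_eq_mul_inv]
  simp only [Function.comp]
  rw [h5, mul_div_cancel_left₀ _ (mul_ne_zero hs0 Complex.I_ne_zero),
    Complex.ofReal_re]

lemma prod_range_two_mul (f : ℕ → ℝ) (n : ℕ) :
    ∏ j ∈ Finset.range (2 * n), f j =
      (∏ i ∈ Finset.range n, f (2 * i)) * ∏ i ∈ Finset.range n, f (2 * i + 1) := by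
  induction n with
  | zero => simp
  | succ n ih =>
    rw [mul_add, mul_one, Finset.prod_range_succ, Finset.prod_range_succ, ih,
      Finset.prod_range_succ, Finset.prod_range_succ]
    ring

lemma one_le_limitProduct_one {q : ℝ} (hq : 0 < q) : 1 ≤ limitProduct 1 q :=
  ge_of_tendsto (tendsto_prod_expRate_one hq) (Eventually.of_forall fun _ =>
    one_le_prod_one_add _ (fun j _ => (inv_pos.2 (expRate_pos 1 j)).le) hq)

lemma sqrt_four_mul (q : ℝ) : √(4 * q) = 2 * √q := by
  rw [Real.sqrt_mul (by norm_num)]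
  congr 1
  rw [show (4 : ℝ) = 2 ^ 2 by norm_num, Real.sqrt_sq (by norm_num)]

lemma limitProduct_one_four_mul {q : ℝ} (hq : 0 < q) :
    limitProduct 1 (4 * q) = Real.cosh √q * limitProduct 1 q := by
  have hs : √q ≠ 0 := (Real.sqrt_pos.2 hq).ne'
  rw [limitProduct, limitProduct, if_neg one_ne_zero, if_neg one_ne_zero, sqrt_four_mul,
    Real.sinh_two_mul]
  field_simp

/-- The product for `cosh` is a quotient of two products for `sinh`, by the duplication formula. At
`4q` and length `2n`, the odd indices reproduce the `sinh` product at `q`; the even ones are the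
factors wanted here. -/
lemma tendsto_prod_expRate_zero {q : ℝ} (hq : 0 < q) :
    Tendsto (fun n => ∏ j ∈ Finset.range n, (1 + q * (expRate 0 j)⁻¹)) atTop
      (𝓝 (limitProduct 0 q)) := by
  have h1 := (tendsto_prod_expRate_one (q := 4 * q) (by positivity)).comp
    (tendsto_id.const_mul_atTop' (two_pos : 0 < 2))
  have hL := (zero_lt_one.trans_le (one_le_limitProduct_one hq)).ne'
  have h2 := h1.div (tendsto_prod_expRate_one hq) hL
  have h3 : limitProduct 1 (4 * q) / limitProduct 1 q = limitProduct 0 q := by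
    rw [limitProduct_one_four_mul hq, mul_div_cancel_right₀ _ hL, limitProduct, if_pos rfl]
  rw [h3] at h2
  refine h2.congr fun n => ?_
  have hne : ∏ j ∈ Finset.range n, (1 + q * (expRate 1 j)⁻¹) ≠ 0 :=
    (zero_lt_one.trans_le
      (one_le_prod_one_add _ (fun j _ => (inv_pos.2 (expRate_pos 1 j)).le) hq)).ne'
  simp only [Function.comp, Pi.div_apply, id]
  rw [prod_range_two_mul, div_eq_iff hne]
  congr 1
  · refine Finset.prod_congr rfl fun i _ => ?_
    unfold expRate
    push_cast
    field_simp
    ring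
  · refine Finset.prod_congr rfl fun i _ => ?_
    unfold expRate
    push_cast
    field_simp
    ring

lemma exists_lt_cosh (M : ℝ) : ∃ q, 0 < q ∧ M < Real.cosh √q := by
  refine ⟨(2 * |M| + 1) ^ 2, by positivity, ?_⟩
  rw [Real.sqrt_sq (by positivity), Real.cosh_eq]
  have h1 := Real.add_one_le_exp (2 * |M| + 1)
  have h2 := Real.exp_pos (-(2 * |M| + 1))
  have h3 := le_abs_self M
  linarith

/-- By duplication, multiplying `q` by 4 multiplies the limit by at least `cosh √q`, which is
unbounded. -/
lemma exists_mul_limitProduct_lt {d : ℕ} (hd : d = 0 ∨ d = 1) (M : ℝ) :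
    ∃ q, 0 < q ∧ M * limitProduct d q < limitProduct d (4 * q) := by
  obtain ⟨q, hq, hM⟩ := exists_lt_cosh M
  refine ⟨q, hq, ?_⟩
  rcases hd with rfl | rfl
  · rw [limitProduct, limitProduct, if_pos rfl, if_pos rfl, sqrt_four_mul, Real.cosh_two_mul,
      Real.sinh_sq]
    have h1 := Real.one_le_cosh √q
    nlinarith
  · rw [limitProduct_one_four_mul hq]
    exact mul_lt_mul_of_pos_right hM (zero_lt_one.trans_le (one_le_limitProduct_one hq))

/-! ### Mellin transforms of the theta-like functions -/

lemma measurable_thetaLike (d : ℕ) : Measurable (thetaLike d) := by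
  unfold thetaLike
  split_ifs
  · exact measurable_const.sub (measurable_const.mul (Measurable.tsum fun k => by fun_prop))
  · exact measurable_const.add (measurable_const.mul (Measurable.tsum fun k => by fun_prop))

/-- The Mellin transform of the theta-like functions. -/
theorem hasMellin_thetaLike {d : ℕ} (hd : d = 0 ∨ d = 1) {w : ℂ} (hw : 0 < w.re) :
    HasMellin (fun t => (thetaLike d t : ℂ)) w
      (mellin (fun q => ((limitProduct d q)⁻¹ : ℝ) : ℝ → ℂ) w / Complex.Gamma (w + 1)) := by
  rcases hd with rfl | rfl
  · have hcoef : ∀ n j, j < n → hypoexpCoeff (expRate 0) n j =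
        (-1) ^ j * (fun j : ℕ => 1 / (2 * (j : ℝ) + 1)) j *
          (fun n : ℕ => (2 * (n : ℝ) - 1) / (n * Real.Wallis.W (n - 1))) n * decayFactor 1 n j :=
      fun n j hj => hypoexpCoeff_expRate_zero hj
    obtain ⟨M, hM⟩ := tendsto_two_mul_sub_one_div_wallis.abs.bddAbove_range
    refine hasMellin_of_tendsto_hypoexpCoeff (expRate_pos 0) (expRate_injective 0)
      (tendsto_hypoexpCoeff_of_eq hcoef tendsto_two_mul_sub_one_div_wallis)
      (M := M) (fun n j hj => abs_hypoexpCoeff_le_of_eq one_pos hcoef (fun j => ?_)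
        (fun n => hM (mem_range_self n)) hj)
      (fun τ hτ => summable_exp_neg_of_eq Real.pi_pos one_pos
        (fun i => by norm_num [expRate]) hτ)
      (fun q hq => tendsto_prod_expRate_zero hq) (exists_mul_limitProduct_lt (Or.inl rfl))
      (measurable_thetaLike 0) (fun t ht => ?_) hw
    · rw [abs_of_nonneg (by positivity), div_le_one (by positivity)]
      linarith [(Nat.cast_nonneg j : (0 : ℝ) ≤ j)]
    · rw [thetaLike, if_pos rfl, ← tsum_mul_left]
      congr 1
      refine tsum_congr fun k => ?_
      have h : -(Real.pi ^ 2 / 4) * (2 * (k : ℝ) + 1) ^ 2 * t⁻¹ = -expRate 0 k * t⁻¹ := by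
        unfold expRate
        push_cast
        ring
      rw [h]
      ring
  · have hcoef : ∀ n j, j < n → hypoexpCoeff (expRate 1) n j =
        (-1) ^ j * (fun _ : ℕ => (1 : ℝ)) j * (fun n : ℕ => 2 * (n : ℝ) / (n + 1)) n *
          decayFactor 2 n j :=
      fun n j hj => hypoexpCoeff_expRate_one hj
    obtain ⟨M, hM⟩ := tendsto_two_mul_div.abs.bddAbove_range
    refine hasMellin_of_tendsto_hypoexpCoeff (expRate_pos 1) (expRate_injective 1)
      (tendsto_hypoexpCoeff_of_eq hcoef tendsto_two_mul_div)
      (M := M) (fun n j hj => abs_hypoexpCoeff_le_of_eq two_pos hcoef (fun j => by simp)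
        (fun n => hM (mem_range_self n)) hj)
      (fun τ hτ => summable_exp_neg_of_eq Real.pi_pos two_pos
        (fun i => by norm_num [expRate]) hτ)
      (fun q hq => tendsto_prod_expRate_one hq) (exists_mul_limitProduct_lt (Or.inr rfl))
      (measurable_thetaLike 1) (fun t ht => ?_) hw
    rw [thetaLike, if_neg one_ne_zero, ← tsum_mul_left, sub_eq_add_neg, ← tsum_neg]
    congr 1
    refine tsum_congr fun k => ?_
    have h : -(Real.pi * ((k : ℝ) + 1)) ^ 2 * t⁻¹ = -expRate 1 k * t⁻¹ := by
      unfold expRate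
      push_cast
      ring
    rw [h]
    ring

/-! ### Polynomials with symmetric real zeros -/

lemma isCoprime_X_sq_sub_C {a b : ℝ} (h : a ≠ b) :
    IsCoprime (X ^ 2 - C a : ℝ[X]) (X ^ 2 - C b) := by
  have h0 : b - a ≠ 0 := sub_ne_zero.2 h.symm
  refine ⟨C (b - a)⁻¹, -C (b - a)⁻¹, ?_⟩
  have h1 : C (b - a)⁻¹ * (X ^ 2 - C a : ℝ[X]) + -C (b - a)⁻¹ * (X ^ 2 - C b) =
      C (b - a)⁻¹ * C (b - a) := by
    rw [C_sub]
    ring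
  rw [h1, ← C_mul, inv_mul_cancel₀ h0, C_1]

lemma isCoprime_X_X_sq_sub_C {a : ℝ} (h : a ≠ 0) : IsCoprime (X : ℝ[X]) (X ^ 2 - C a) := by
  refine ⟨C a⁻¹ * X, -C a⁻¹, ?_⟩
  have h1 : C a⁻¹ * X * (X : ℝ[X]) + -C a⁻¹ * (X ^ 2 - C a) = C a⁻¹ * C a := by ring
  rw [h1, ← C_mul, inv_mul_cancel₀ h, C_1]

lemma X_sq_sub_C_sq_dvd {P : ℝ[X]} {y : ℝ} (hy : 0 < y) (h1 : P.IsRoot y) (h2 : P.IsRoot (-y)) :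
    (X ^ 2 - C (y ^ 2) : ℝ[X]) ∣ P := by
  have h3 : (X ^ 2 - C (y ^ 2) : ℝ[X]) = (X - C y) * (X - C (-y)) := by
    rw [C_pow, C_neg]
    ring
  rw [h3]
  refine IsCoprime.mul_dvd (isCoprime_X_sub_C_of_isUnit_sub ?_) (dvd_iff_isRoot.2 h1)
    (dvd_iff_isRoot.2 h2)
  exact (show y - -y ≠ 0 by linarith).isUnit

/-- A monic polynomial of degree `2 N + d` and parity `d` with `N` distinct positive zeros. -/
lemma eq_X_pow_mul_prod {d N : ℕ} (hd : d = 0 ∨ d = 1) {P : ℝ[X]} (hmonic : P.Monic)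
    (hdeg : P.natDegree = 2 * N + d) (hpar : P.comp (-X) = (-1) ^ d * P) {y : ℕ → ℝ}
    (hpos : ∀ k ∈ Finset.Icc 1 N, 0 < y k) (hroot : ∀ k ∈ Finset.Icc 1 N, P.IsRoot (y k))
    (hinj : Set.InjOn y (Finset.Icc 1 N : Finset ℕ)) :
    P = X ^ d * ∏ k ∈ Finset.Icc 1 N, (X ^ 2 - C (y k ^ 2)) := by
  have heval : ∀ t, P.eval (-t) = (-1) ^ d * P.eval t := by
    intro t
    have := congrArg (Polynomial.eval t) hpar
    simpa using this
  have hm : ∀ k ∈ Finset.Icc 1 N, (X ^ 2 - C (y k ^ 2) : ℝ[X]).Monic := fun k _ =>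
    monic_X_pow_sub_C _ two_ne_zero
  have hdvd1 : ∏ k ∈ Finset.Icc 1 N, (X ^ 2 - C (y k ^ 2)) ∣ P := by
    refine Finset.prod_dvd_of_coprime (fun k hk l hl hkl => isCoprime_X_sq_sub_C fun h => hkl ?_)
      fun k hk => X_sq_sub_C_sq_dvd (hpos k hk) (hroot k hk) ?_
    · exact hinj hk hl ((pow_left_inj₀ (hpos k hk).le (hpos l hl).le two_ne_zero).1 h)
    · rw [IsRoot, heval, (hroot k hk).eq_zero, mul_zero]
  have hdvd : X ^ d * ∏ k ∈ Finset.Icc 1 N, (X ^ 2 - C (y k ^ 2)) ∣ P := by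
    refine IsCoprime.mul_dvd (IsCoprime.pow_left (IsCoprime.prod_right fun k hk =>
      isCoprime_X_X_sq_sub_C (pow_ne_zero 2 (hpos k hk).ne'))) ?_ hdvd1
    rcases hd with rfl | rfl
    · simp
    · rw [pow_one, X_dvd_iff, coeff_zero_eq_eval_zero]
      have := heval 0
      rw [neg_zero] at this
      linarith
  -- The factors found so far already account for the full degree `2N + d`, so no other zero is
  -- possible.
  refine eq_of_monic_of_dvd_of_natDegree_le ((monic_X_pow d).mul (monic_prod_of_monic _ _ hm))
    hmonic hdvd ?_
  rw [Monic.natDegree_mul (monic_X_pow d) (monic_prod_of_monic _ _ hm), natDegree_X_pow,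
    natDegree_prod_of_monic _ _ hm, hdeg]
  simp only [natDegree_X_pow_sub_C, Finset.sum_const, Nat.card_Icc, smul_eq_mul]
  omega

lemma eval_iterate_derivative_X_pow_mul {d : ℕ} (hd : d = 0 ∨ d = 1) (R : ℝ[X]) :
    (derivative^[d] (X ^ d * R)).eval 0 = R.eval 0 := by
  rcases hd with rfl | rfl <;> simp

lemma normalized_aeval_eq {d N : ℕ} (hd : d = 0 ∨ d = 1) {y : ℕ → ℝ}
    (hpos : ∀ k ∈ Finset.Icc 1 N, 0 < y k) {b : ℝ} (hb : 0 < b) {q : ℝ} (hq : 0 < q) :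
    (b : ℂ) ^ d * aeval ((√q * Complex.I : ℂ) / b)
        (X ^ d * ∏ k ∈ Finset.Icc 1 N, (X ^ 2 - C (y k ^ 2)) : ℝ[X]) /
        (((derivative^[d] (X ^ d * ∏ k ∈ Finset.Icc 1 N, (X ^ 2 - C (y k ^ 2)))).eval 0 : ℝ) : ℂ) =
      (√q * Complex.I) ^ d *
        ((∏ k ∈ Finset.Icc 1 N, (1 + q * (b ^ 2 * y k ^ 2)⁻¹) : ℝ) : ℂ) := by
  have hb0 : (b : ℂ) ≠ 0 := by exact_mod_cast hb.ne'
  have hs : (√q : ℂ) ^ 2 = q := by exact_mod_cast Real.sq_sqrt hq.le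
  rw [eval_iterate_derivative_X_pow_mul hd, map_mul, map_pow, aeval_X, map_prod, eval_prod,
    Complex.ofReal_prod, Complex.ofReal_prod, mul_div_assoc, mul_div_assoc,
    ← Finset.prod_div_distrib, ← mul_assoc, ← mul_pow, mul_div_cancel₀ _ hb0]
  congr 1
  refine Finset.prod_congr rfl fun k hk => ?_
  have hy : (y k : ℂ) ≠ 0 := by exact_mod_cast (hpos k hk).ne'
  simp only [map_sub, map_pow, aeval_X, aeval_C, eval_sub, eval_pow, eval_X, eval_C,
    Complex.coe_algebraMap]
  rw [div_pow, mul_pow, hs, Complex.I_sq]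
  push_cast
  field_simp
  ring

lemma cos_sub_eq {d : ℕ} (hd : d = 0 ∨ d = 1) {q : ℝ} (hq : 0 < q) :
    Complex.cos (√q * Complex.I - d * Real.pi / 2) =
      (√q * Complex.I) ^ d * ((limitProduct d q : ℝ) : ℂ) := by
  have hs : (√q : ℂ) ≠ 0 := by exact_mod_cast (Real.sqrt_pos.2 hq).ne'
  rcases hd with rfl | rfl
  · simp [limitProduct, Complex.cos_mul_I]
  · rw [Nat.cast_one, one_mul, Complex.cos_sub_pi_div_two, Complex.sin_mul_I, limitProduct,
      if_neg one_ne_zero, pow_one]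
    push_cast
    field_simp

variable {d : ℕ} {β γ δ : ℕ → ℝ} {P : ℕ → ℝ[X]} {x : ℕ → ℕ → ℝ} {u : ℕ → ℝ}

lemma zeros_pos (hx : ∀ N, 1 ≤ N → Set.BijOn (x N) (Icc 1 N) {r : ℝ | 0 < r ∧ (P N).IsRoot r})
    {N : ℕ} (hN : 1 ≤ N) {k : ℕ} (hk : k ∈ Finset.Icc 1 N) : 0 < x N k :=
  ((hx N hN).mapsTo (by simpa using hk)).1

/-- At `z = i√q` each pair of zeros `±x_k` contributes the real factor `1 + q / (β x_k)²`, and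
`(i√q)^d` is common to the normalised polynomial and the cosine. For fixed `q` the disk condition
eventually holds, and the error is a constant times `δ N`. -/
theorem PolyClass.tendsto_prod (hd : d = 0 ∨ d = 1) (hP : PolyClass d β γ δ P)
    (hx : ∀ N, 1 ≤ N → Set.BijOn (x N) (Icc 1 N) {r : ℝ | 0 < r ∧ (P N).IsRoot r})
    {q : ℝ} (hq : 0 < q) :
    Tendsto (fun N => ∏ k ∈ Finset.Icc 1 N, (1 + q * (β N ^ 2 * x N k ^ 2)⁻¹)) atTop
      (𝓝 (limitProduct d q)) := by
  obtain ⟨c, hc, hasymp⟩ := hP.asymp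
  have hs : 0 < √q := Real.sqrt_pos.2 hq
  have hnorm : ‖(√q * Complex.I : ℂ)‖ = √q := by
    rw [norm_mul, Complex.norm_I, mul_one, Complex.norm_real, Real.norm_of_nonneg hs.le]
  have hδ : Tendsto δ atTop (𝓝 0) := 
    hP.delta_lim.inv_tendsto_atTop.congr fun N => inv_inv (δ N)
  have hbound : Tendsto (fun N => c * (δ N * min (√q ^ 2) 1 * hyp d √q) / √q ^ d) atTop (𝓝 0) := by
    simpa using (((hδ.mul_const (min (√q ^ 2) 1)).mul_const (hyp d √q)).const_mul c).div_const
      (√q ^ d)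
  rw [tendsto_iff_norm_sub_tendsto_zero]
  refine squeeze_zero' (Eventually.of_forall fun _ => norm_nonneg _) ?_ hbound
  filter_upwards [eventually_ge_atTop 1, hP.gamma_lim.eventually_ge_atTop √q] with N hN hγ
  have h1 := hasymp N hN (√q * Complex.I) (hnorm.trans_le hγ)
  have hpos : ∀ k ∈ Finset.Icc 1 N, 0 < x N k := fun k hk => zeros_pos hx hN hk
  have hPN := eq_X_pow_mul_prod hd (hP.monic N hN) (hP.natDegree_eq N hN) (hP.parity N hN) hpos
    (fun k hk => ((hx N hN).mapsTo (by simpa using hk)).2)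
    (by simpa using (hx N hN).injOn)
  rw [hPN, normalized_aeval_eq hd hpos (hP.beta_pos N hN) hq, cos_sub_eq hd hq, ← mul_sub,
    norm_mul, norm_pow, hnorm, ← Complex.ofReal_sub, Complex.norm_real] at h1
  rw [le_div_iff₀ (by positivity), mul_comm]
  exact h1

/-! ### The limit of the scaled Mellin transforms -/

/-- The nonzero knots `u²`, `x_k²`. -/
def posKnots (N : ℕ) (u : ℝ) (x : ℕ → ℝ) : Finset ℝ :=
  insert (u ^ 2) ((Finset.Icc 1 N).image fun k => x k ^ 2)

section Knots

variable {N : ℕ} {v : ℝ} {y : ℕ → ℝ}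

lemma injOn_sq (hpos : ∀ k ∈ Finset.Icc 1 N, 0 < y k)
    (hinj : Set.InjOn y (Finset.Icc 1 N : Finset ℕ)) :
    Set.InjOn (fun k => y k ^ 2) (Finset.Icc 1 N : Finset ℕ) := fun k hk l hl h =>
  hinj hk hl ((pow_left_inj₀ (hpos k hk).le (hpos l hl).le two_ne_zero).1 h)

lemma sq_notMem_image (hv : 0 < v) (hpos : ∀ k ∈ Finset.Icc 1 N, 0 < y k)
    (hne : ∀ k ∈ Finset.Icc 1 N, v ≠ y k) :
    v ^ 2 ∉ (Finset.Icc 1 N).image fun k => y k ^ 2 := by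
  intro h
  obtain ⟨k, hk, hkv⟩ := Finset.mem_image.1 h
  exact hne k hk ((pow_left_inj₀ (hpos k hk).le hv.le two_ne_zero).1 hkv).symm

lemma prod_posKnots (hv : 0 < v) (hpos : ∀ k ∈ Finset.Icc 1 N, 0 < y k)
    (hinj : Set.InjOn y (Finset.Icc 1 N : Finset ℕ)) (hne : ∀ k ∈ Finset.Icc 1 N, v ≠ y k)
    (f : ℝ → ℝ) :
    ∏ w ∈ posKnots N v y, f w = f (v ^ 2) * ∏ k ∈ Finset.Icc 1 N, f (y k ^ 2) := by
  rw [posKnots, Finset.prod_insert (sq_notMem_image hv hpos hne),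
    Finset.prod_image (injOn_sq hpos hinj)]

lemma card_posKnots (hv : 0 < v) (hpos : ∀ k ∈ Finset.Icc 1 N, 0 < y k)
    (hinj : Set.InjOn y (Finset.Icc 1 N : Finset ℕ)) (hne : ∀ k ∈ Finset.Icc 1 N, v ≠ y k) :
    (posKnots N v y).card = N + 1 := by
  rw [posKnots, Finset.card_insert_of_notMem (sq_notMem_image hv hpos hne),
    Finset.card_image_of_injOn (injOn_sq hpos hinj), Nat.card_Icc, Nat.add_sub_cancel]

lemma posKnots_pos (hv : 0 < v) (hpos : ∀ k ∈ Finset.Icc 1 N, 0 < y k) :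
    ∀ w ∈ posKnots N v y, 0 < w := by
  intro w hw
  rcases Finset.mem_insert.1 hw with rfl | hw
  · positivity
  · obtain ⟨k, hk, rfl⟩ := Finset.mem_image.1 hw
    exact pow_pos (hpos k hk) 2

/-- The scaled Mellin transform times the Mellin transform of `q (1 + q / N) ^ (-N - 2)`. -/
lemma scaledMellin_mul_mellin (hN : 1 ≤ N) (hv : 0 < v) (hpos : ∀ k ∈ Finset.Icc 1 N, 0 < y k)
    (hinj : Set.InjOn y (Finset.Icc 1 N : Finset ℕ)) (hne : ∀ k ∈ Finset.Icc 1 N, v ≠ y k)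
    {b : ℝ} (hb : 0 < b) {w : ℂ} (hw : 0 < w.re)
    (hk : MellinConvergent (fun q : ℝ => ((q * ((1 + q / N) ^ (N + 2))⁻¹ : ℝ) : ℂ)) w) :
    scaledMellin N b v y w *
        mellin (fun q : ℝ => ((q * ((1 + q / N) ^ (N + 2))⁻¹ : ℝ) : ℂ)) w =
      mellin (fun q : ℝ =>
        (((∏ p ∈ posKnots N v y, (1 + q * (b ^ 2 * p)⁻¹))⁻¹ : ℝ) : ℂ)) w := by
  have hV := posKnots_pos hv hpos
  have hcard := card_posKnots hv hpos hinj hne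
  have hN0 : (0 : ℝ) < N := by exact_mod_cast hN
  have hprod : ∏ p ∈ posKnots N v y, p = v ^ 2 * ∏ k ∈ Finset.Icc 1 N, y k ^ 2 :=
    prod_posKnots hv hpos hinj hne fun p => p
  set c : ℝ := (∏ p ∈ posKnots N v y, p) / N with hc
  have hconv : MellinConvergent
      (fun t : ℝ => ((bSplineStar N (knots N v y) (N / b ^ 2 * t) : ℝ) : ℂ)) w :=
    (MellinConvergent.comp_mul_left (f := fun t => ((bSplineStar N (knots N v y) t : ℝ) : ℂ))
      (by positivity)).2 (mellinConvergent_bSplineStar hN hV hcard hw)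
  have hscaled : scaledMellin N b v y w =
      mellin (fun t : ℝ => ((c * bSplineStar N (knots N v y) (N / b ^ 2 * t) : ℝ) : ℂ)) w := by
    rw [scaledMellin, ← hprod, ← hc, ← smul_eq_mul, ← mellin_const_smul]
    simp only [smul_eq_mul, Complex.ofReal_mul]
  have hconv' : MellinConvergent
      (fun t : ℝ => ((c * bSplineStar N (knots N v y) (N / b ^ 2 * t) : ℝ) : ℂ)) w := by
    have := hconv.const_smul (c : ℂ)
    simpa only [smul_eq_mul, Complex.ofReal_mul] using this
  rw [hscaled]
  refine (mellin_eq_mul_of_conv ?_ ?_ hconv' hk fun q hq => ?_).symm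
  · exact ((measurable_bSplineStar N _).comp (measurable_const_mul _)).const_mul c
  · fun_prop
  · exact integral_scaled_bSplineStar_mul hN hV hcard hb hq

end Knots

lemma tendsto_prod_posKnots (hd : d = 0 ∨ d = 1) (hP : PolyClass d β γ δ P)
    (hx : ∀ N, 1 ≤ N → Set.BijOn (x N) (Icc 1 N) {r : ℝ | 0 < r ∧ (P N).IsRoot r})
    (hu_pos : ∀ N, 1 ≤ N → 0 < u N) (hu_ne : ∀ N, 1 ≤ N → ∀ k ∈ Icc 1 N, u N ≠ x N k)
    (hu_lim : Tendsto (fun N => β N * u N) atTop atTop) {q : ℝ} (hq : 0 < q) :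
    Tendsto (fun N => ∏ p ∈ posKnots N (u N) (x N), (1 + q * (β N ^ 2 * p)⁻¹)) atTop
      (𝓝 (limitProduct d q)) := by
  have h1 : Tendsto (fun N => ((β N * u N) ^ 2)⁻¹) atTop (𝓝 0) :=
    ((tendsto_pow_atTop two_ne_zero).comp hu_lim).inv_tendsto_atTop
  have h2 := ((h1.const_mul q).const_add 1).mul (hP.tendsto_prod hd hx hq)
  rw [mul_zero, add_zero, one_mul] at h2
  refine h2.congr' ?_
  filter_upwards [eventually_ge_atTop 1] with N hN
  rw [prod_posKnots (hu_pos N hN) (fun k hk => zeros_pos hx hN hk)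
    (by simpa using (hx N hN).injOn) (fun k hk => hu_ne N hN k (by simpa using hk))
    (fun p => 1 + q * (β N ^ 2 * p)⁻¹), mul_pow]

/-! ### The kernels `q (1 + q/N)^(-N-2)` and their limit -/

lemma tendsto_prod_range_exp (q : ℝ) :
    Tendsto (fun N : ℕ => ∏ _j ∈ Finset.range (N + 2), (1 + q * (N : ℝ)⁻¹)) atTop
      (𝓝 (Real.exp q)) := by
  have h1 : Tendsto (fun N : ℕ => 1 + q * (N : ℝ)⁻¹) atTop (𝓝 1) := by
    simpa using ((tendsto_inv_atTop_nhds_zero_nat (𝕜 := ℝ)).const_mul q).const_add 1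
  have h2 := (Real.tendsto_one_add_div_pow_exp q).mul (h1.pow 2)
  rw [one_pow, mul_one] at h2
  refine h2.congr fun N => ?_
  rw [Finset.prod_const, Finset.card_range, pow_add, div_eq_mul_inv]

lemma exists_mul_exp_lt (M : ℝ) : ∃ q, 0 < q ∧ M * Real.exp q < Real.exp (4 * q) := by
  refine ⟨|M| + 1, by positivity, ?_⟩
  have h1 : Real.exp (4 * (|M| + 1)) = Real.exp (3 * (|M| + 1)) * Real.exp (|M| + 1) := by
    rw [← Real.exp_add]
    ring_nf
  rw [h1]
  refine mul_lt_mul_of_pos_right ?_ (Real.exp_pos _)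
  have h2 := Real.add_one_le_exp (3 * (|M| + 1))
  have h3 := le_abs_self M
  have h4 := abs_nonneg M
  linarith

/-- The Mellin transforms of `q (1 + q / N) ^ (-N - 2)` converge to `Γ (w + 1)`. -/
lemma tendstoUniformlyOn_mellin_kernel {σ : ℝ} (hσ : 0 < σ) :
    (∀ᶠ N : ℕ in atTop, ∀ w : ℂ, w.re = σ →
      MellinConvergent (fun q : ℝ => ((q * ((1 + q / N) ^ (N + 2))⁻¹ : ℝ) : ℂ)) w) ∧
    TendstoUniformlyOn
      (fun (N : ℕ) w => mellin (fun q : ℝ => ((q * ((1 + q / N) ^ (N + 2))⁻¹ : ℝ) : ℂ)) w)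
      (fun w => Complex.Gamma (w + 1)) atTop {w : ℂ | w.re = σ} := by
  -- The kernel is `q` over a product of `N + 2` equal factors `1 + q/N`, so the general convergence
  -- theorem applies again; the factor `q` shifts the exponent to `σ + 1`.
  obtain ⟨h1, h2, h3⟩ := tendsto_integral_abs_inv_prod_sub
    (s := fun N => Finset.range (N + 2)) (y := fun N _ => (N : ℝ)⁻¹)
    (Eventually.of_forall fun N j _ => by positivity) (fun q _ => tendsto_prod_range_exp q)
    exists_mul_exp_lt (σ := σ + 1) (by linarith)
  have hprod : ∀ (N : ℕ) (q : ℝ), ∏ _j ∈ Finset.range (N + 2), (1 + q * (N : ℝ)⁻¹) =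
      (1 + q / N) ^ (N + 2) := fun N q => by
    rw [Finset.prod_const, Finset.card_range, div_eq_mul_inv]
  have hpow : ∀ q ∈ Ioi (0 : ℝ), ∀ z, q ^ (σ + 1 - 1) * z = q ^ (σ - 1) * (q * z) := by
    intro q hq z
    rw [add_sub_cancel_right, Real.rpow_sub_one (show (0 : ℝ) < q from hq).ne']
    have : q ≠ 0 := (show (0 : ℝ) < q from hq).ne'
    field_simp
  simp only [hprod] at h1 h3
  have g1 : ∀ᶠ N : ℕ in atTop, IntegrableOn
      (fun q : ℝ => q ^ (σ - 1) * (q * ((1 + q / N) ^ (N + 2))⁻¹)) (Ioi 0) :=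
    h1.mono fun N hN => hN.congr_fun (fun q hq => hpow q hq _) measurableSet_Ioi
  have g2 : IntegrableOn (fun q : ℝ => q ^ (σ - 1) * (q * (Real.exp q)⁻¹)) (Ioi 0) :=
    h2.congr_fun (fun q hq => hpow q hq _) measurableSet_Ioi
  have g3 : Tendsto (fun N : ℕ => ∫ q in Ioi (0 : ℝ),
      |q ^ (σ - 1) * (q * ((1 + q / N) ^ (N + 2))⁻¹) - q ^ (σ - 1) * (q * (Real.exp q)⁻¹)|) atTop (𝓝 0) :=
    h3.congr fun N => setIntegral_congr_fun measurableSet_Ioi fun q hq => by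
      simp only [hpow q hq]
  refine ⟨g1.mono fun N hN w hw => ?_, ?_⟩
  · rw [mellinConvergent_ofReal_iff (by fun_prop), hw]
    refine hN.congr_fun (fun q hq => ?_) measurableSet_Ioi
    have hq : (0 : ℝ) < q := hq
    rw [abs_of_nonneg (by positivity)]
  · refine (tendstoUniformlyOn_mellin_of_tendsto g1 g2 g3).congr_right fun w hw => ?_
    exact mellin_gammaKernel (by rw [show w.re = σ from hw]; exact hσ)

/-- `Γ` is continuous and zero-free where the real part is positive. Compactness is essential, since
`Γ` decays along vertical lines. -/
lemma exists_le_norm_Gamma_add_one {σ : ℝ} (hσ : 0 < σ) {K : Set ℂ} (hK : IsCompact K)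
    (hKσ : ∀ w ∈ K, w.re = σ) : ∃ m, 0 < m ∧ ∀ w ∈ K, m ≤ ‖Complex.Gamma (w + 1)‖ := by
  rcases K.eq_empty_or_nonempty with rfl | hne
  · exact ⟨1, one_pos, by simp⟩
  have hre : ∀ w ∈ K, 0 < (w + 1).re := fun w hw => by
    rw [Complex.add_re, hKσ w hw, Complex.one_re]
    linarith
  have hcont : ContinuousOn (fun w => ‖Complex.Gamma (w + 1)‖) K := by
    intro w hw
    have h1 : DifferentiableAt ℂ Complex.Gamma (w + 1) := by
      refine Complex.differentiableAt_Gamma _ fun m hm => ?_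
      have h2 := hre w hw
      rw [hm, Complex.neg_re, Complex.natCast_re] at h2
      linarith [(Nat.cast_nonneg m : (0 : ℝ) ≤ m)]
    have h3 : ContinuousAt (fun w : ℂ => Complex.Gamma (w + 1)) w :=
      ContinuousAt.comp (f := fun w : ℂ => w + 1) h1.continuousAt (by fun_prop)
    exact h3.norm.continuousWithinAt
  obtain ⟨w₀, hw₀, hmin⟩ := hK.exists_isMinOn hne hcont
  exact ⟨_, norm_pos_iff.2 (Complex.Gamma_ne_zero_of_re_pos (hre w₀ hw₀)), fun w hw => hmin hw⟩

theorem tendstoUniformlyOn_scaledMellin (hd : d = 0 ∨ d = 1) (hP : PolyClass d β γ δ P)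
    (hx : ∀ N, 1 ≤ N → Set.BijOn (x N) (Icc 1 N) {r : ℝ | 0 < r ∧ (P N).IsRoot r})
    (hu_pos : ∀ N, 1 ≤ N → 0 < u N) (hu_ne : ∀ N, 1 ≤ N → ∀ k ∈ Icc 1 N, u N ≠ x N k)
    (hu_lim : Tendsto (fun N => β N * u N) atTop atTop) {σ : ℝ} (hσ : 0 < σ) {K : Set ℂ}
    (hK : IsCompact K) (hKσ : ∀ w ∈ K, w.re = σ) :
    TendstoUniformlyOn (fun N w => scaledMellin N (β N) (u N) (x N) w)
      (fun w => mellin (fun t : ℝ => ((thetaLike d t : ℝ) : ℂ)) w) atTop K := by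
  have hpos : ∀ N, 1 ≤ N → ∀ k ∈ Finset.Icc 1 N, 0 < x N k := fun N hN k hk => zeros_pos hx hN hk
  have hinj : ∀ N, 1 ≤ N → Set.InjOn (x N) (Finset.Icc 1 N : Finset ℕ) := fun N hN => by
    simpa using (hx N hN).injOn
  have hne : ∀ N, 1 ≤ N → ∀ k ∈ Finset.Icc 1 N, u N ≠ x N k := fun N hN k hk =>
    hu_ne N hN k (by simpa using hk)
  obtain ⟨h1, h2, h3⟩ := tendsto_integral_abs_inv_prod_sub
    (s := fun N => posKnots N (u N) (x N)) (y := fun N p => (β N ^ 2 * p)⁻¹)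
    (by
      filter_upwards [eventually_ge_atTop 1] with N hN p hp
      have := posKnots_pos (hu_pos N hN) (hpos N hN) p hp
      positivity)
    (fun q hq => tendsto_prod_posKnots hd hP hx hu_pos hu_ne hu_lim hq)
    (exists_mul_limitProduct_lt hd) hσ
  have hA := (tendstoUniformlyOn_mellin_of_tendsto h1 h2 h3).mono hKσ
  obtain ⟨hkconv, hkunif⟩ := tendstoUniformlyOn_mellin_kernel hσ
  have hB := hkunif.mono hKσ
  obtain ⟨m, hm, hmle⟩ := exists_le_norm_Gamma_add_one hσ hK hKσ
  have hbound : ∀ w ∈ K, ‖mellin (fun q : ℝ => (((limitProduct d q)⁻¹ : ℝ) : ℂ)) w‖ ≤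
      ∫ q in Ioi (0 : ℝ), |q ^ (σ - 1) * (limitProduct d q)⁻¹| := by
    intro w hw
    refine (norm_integral_le_integral_norm _).trans_eq ?_
    refine setIntegral_congr_fun measurableSet_Ioi fun q hq => ?_
    have hq : (0 : ℝ) < q := hq
    simp only
    rw [norm_smul, Complex.norm_cpow_eq_rpow_re_of_pos hq, Complex.norm_real, abs_mul,
      abs_of_pos (Real.rpow_pos_of_pos hq _), Complex.sub_re, Complex.one_re, hKσ w hw,
      Real.norm_eq_abs]
  have hquot := tendstoUniformlyOn_div_of_bounds hA hB hm hbound hmle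
  refine (hquot.congr ?_).congr_right fun w hw => ?_
  · rw [Metric.tendstoUniformlyOn_iff] at hB
    filter_upwards [eventually_ge_atTop 1, hkconv, hB m hm] with N hN hconv hclose w hw
    -- The denominator is strictly closer than `m` to a value of norm at least `m`, so it cannot
    -- vanish and the product formula can be divided.
    have hne0 : mellin (fun q : ℝ => ((q * ((1 + q / N) ^ (N + 2))⁻¹ : ℝ) : ℂ)) w ≠ 0 := by
      intro h0
      have h4 := hclose w hw
      rw [h0, dist_zero_right] at h4
      exact (hmle w hw).not_gt h4
    rw [div_eq_iff hne0]
    exact (scaledMellin_mul_mellin hN (hu_pos N hN) (hpos N hN) (hinj N hN) (hne N hN)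
      (hP.beta_pos N hN) (by rw [hKσ w hw]; exact hσ) (hconv w (hKσ w hw))).symm
  · exact (hasMellin_thetaLike hd (by rw [hKσ w hw]; exact hσ)).2.symm

lemma re_sub_natCast_div_two (s : ℂ) (d : ℕ) : ((s - d) / 2).re = (s.re - d) / 2 := by
  have h : (s - d) / 2 = ((1 / 2 : ℝ) : ℂ) * (s - d) := by
    push_cast
    ring
  rw [h, Complex.re_ofReal_mul, Complex.sub_re, Complex.natCast_re]
  ring

end BSplineMellin

end

theorem theorem5p1 (d : ℕ) (hd : d = 0 ∨ d = 1) (β γ δ : ℕ → ℝ) (P : ℕ → Polynomial ℝ)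
    (hP : BSplineMellin.PolyClass d β γ δ P)
    (x : ℕ → ℕ → ℝ)
    (hx : ∀ N, 1 ≤ N →
      Set.BijOn (x N) (Set.Icc 1 N) {r : ℝ | 0 < r ∧ (P N).IsRoot r})
    (u : ℕ → ℝ) (hu_pos : ∀ N, 1 ≤ N → 0 < u N)
    (hu_ne : ∀ N, 1 ≤ N → ∀ k ∈ Set.Icc 1 N, u N ≠ x N k)
    (hu_lim : Tendsto (fun N => β N * u N) atTop atTop) :
    (∀ s : ℂ, (d : ℝ) < s.re →
      (∀ N, 1 ≤ N →
        MellinConvergent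
          (fun t : ℝ => ((BSplineMellin.bSplineStar N (BSplineMellin.knots N (u N) (x N))
            (N / β N ^ 2 * t) : ℝ) : ℂ)) ((s - d) / 2)) ∧
      MellinConvergent (fun t : ℝ => ((BSplineMellin.thetaLike d t : ℝ) : ℂ)) ((s - d) / 2) ∧
      Tendsto
        (fun N => BSplineMellin.scaledMellin N (β N) (u N) (x N) ((s - d) / 2))
        atTop
        (𝓝 (mellin (fun t : ℝ => ((BSplineMellin.thetaLike d t : ℝ) : ℂ)) ((s - d) / 2)))) ∧
    (∀ r : ℝ, (d : ℝ) < r → ∀ K : Set ℂ, IsCompact K → (∀ s ∈ K, s.re = r) →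
      TendstoUniformlyOn
        (fun N (s : ℂ) => BSplineMellin.scaledMellin N (β N) (u N) (x N) ((s - d) / 2))
        (fun s : ℂ =>
          mellin (fun t : ℝ => ((BSplineMellin.thetaLike d t : ℝ) : ℂ)) ((s - d) / 2))
        atTop K) := by
  have huniform : ∀ r : ℝ, (d : ℝ) < r → ∀ K : Set ℂ, IsCompact K → (∀ s ∈ K, s.re = r) →
      TendstoUniformlyOn
        (fun N (s : ℂ) => BSplineMellin.scaledMellin N (β N) (u N) (x N) ((s - d) / 2))
        (fun s : ℂ =>
          mellin (fun t : ℝ => ((BSplineMellin.thetaLike d t : ℝ) : ℂ)) ((s - d) / 2))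
        atTop K := by
    intro r hr K hK hKr
    -- The affine map `s ↦ (s - d) / 2` carries `K` to a compact subset of the line `Re w = (r - d)
    -- / 2`.
    have h := BSplineMellin.tendstoUniformlyOn_scaledMellin hd hP hx hu_pos hu_ne hu_lim
      (σ := (r - d) / 2) (by linarith) (K := (fun s : ℂ => (s - d) / 2) '' K)
      (hK.image (by fun_prop)) (by
        rintro _ ⟨s, hs, rfl⟩
        rw [BSplineMellin.re_sub_natCast_div_two, hKr s hs])
    exact (h.comp fun s : ℂ => (s - d) / 2).mono (Set.subset_preimage_image _ _)
  refine ⟨fun s hs => ⟨fun N hN => ?_, ?_, ?_⟩, huniform⟩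
  · have hpos : ∀ k ∈ Finset.Icc 1 N, 0 < x N k := fun k hk => BSplineMellin.zeros_pos hx hN hk
    have hβ := hP.beta_pos N hN
    have hN0 : (0 : ℝ) < N := by exact_mod_cast hN
    refine (MellinConvergent.comp_mul_left
      (f := fun t => ((BSplineMellin.bSplineStar N (BSplineMellin.knots N (u N) (x N)) t : ℝ) : ℂ))
      (by positivity)).2 ?_
    refine BSplineMellin.mellinConvergent_bSplineStar hN
      (BSplineMellin.posKnots_pos (hu_pos N hN) hpos)
      (BSplineMellin.card_posKnots (hu_pos N hN) hpos (by simpa using (hx N hN).injOn)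
        fun k hk => hu_ne N hN k (by simpa using hk)) ?_
    rw [BSplineMellin.re_sub_natCast_div_two]
    linarith
  · refine (BSplineMellin.hasMellin_thetaLike hd ?_).1
    rw [BSplineMellin.re_sub_natCast_div_two]
    linarith
  · exact (huniform s.re hs {s} isCompact_singleton (by simp)).tendsto_at (Set.mem_singleton s)
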